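/- Let $k\ge 1$, $0<H\le 1$, $L>0$, $M>0$, and let $\|\cdot\|$ be the Euclidean norm on $\mathbb{R}^k$. For Borel probability measures $Q_1,Q_2$ on $\mathbb{R}$ put $\mathcal W_1(Q_1,Q_2)=\inf_\pi\int|y_1-y_2|\,\pi(\mathrm dy_1\mathrm dy_2)\in[0,\infty]$, the infimum being over all measures $\pi$ on $\mathbb{R}^2$ with margins $Q_1$ and $Q_2$. Let $\mathcal D(H,L,M)$ be the class of distributions $P$ of pairs $(X,Y)$ on $\mathbb{R}^k\times\mathbb{R}$ such that $X\in[0,1]^k$ a.s., $\mathbb{E}|Y|<\infty$, and there is a version $(F_x)$ of the conditional distribution of $Y$ given $X=x$ (identified with its distribution functions) with $$\mathcal W_1(F_x,F_{x'})\le L\|x-x'\|^H\quad\text{and}\quad\int_{\mathbb{R}}\sqrt{F_x(z)(1-F_x(z))}\,\mathrm dz\le M\qquad\text{for all }x,x'\in[0,1]^k .$$ Let $(X_1,Y_1),\dots,(X_n,Y_n)$ and $(X,Y)$ be independent with distribution $P$. Write $a_n\asymp b_n$ if $a_n/b_n$ and $b_n/a_n$ remain bounded as $n\to\infty$. Then $$\inf_{\hat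 F_n}\ \sup_{P\in\mathcal D(H,L,M)}\mathbb{E}\big[\mathcal W_1(\hat F_{n,X},F_X)\big]\asymp n^{-H/(2H+k)},$$ where the infimum is over all estimators, i.e. all measurable maps $\hat F_n$ that send a sample $((X_i,Y_i))_{1\le i\le n}$ and a point $x\in\mathbb{R}^k$ to a probability measure $\hat F_{n,x}$ on $\mathbb{R}$. Moreover, $\sup_{P\in\mathcal D(H,L,M)}\mathbb{E}[\mathcal W_1(\hat F_{n,X},F_X)]\asymp n^{-H/(2H+k)}$ holds for the following estimators $\hat F_{n,x}=\sum_{i=1}^n W_{ni}(x)\delta_{Y_i}$: 1. (kernel method, any $k\ge 1$) $W_{ni}(x)=K\big(\tfrac{x-X_i}{h_n}\big)\big/\sum_{j=1}^n K\big(\tfrac{x-X_j}{h_n}\big)$ if the denominator is nonzero and $W_{ni}(x)=1/n$ otherwise, where $h_n>0$, $h_n\asymp n^{-1/(2H+k)}$, and $K$ is any boxed kernel, i.e. a measurable function for which there are constants $R_2\ge R_1>0$ and $M_2\ge M_1>0$ with $M_1\mathbf 1_{\{\|x\|\le R_1\}}\le K(x)\le M_2\mathbf 1_{\{\|x\|\le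 R_2\}}$ for all $x\in\mathbb{R}^k$ (for instance the uniform kernel $K(x)=\mathbf 1_{\{\|x\|\le 1\}}$); 2. (nearest neighbour method, $k\ge 2$) $W_{ni}(x)=1/\kappa_n$ if $X_i$ is one of the $\kappa_n$ nearest neighbours of $x$ among $X_1,\dots,X_n$ and $W_{ni}(x)=0$ otherwise, where $\kappa_n\in\{1,\dots,n\}$, $\kappa_n\asymp n^{H/(H+k/2)}$, and ties are broken by any measurable rule that depends only on $x$, $X_1,\dots,X_n$ and possibly on auxiliary randomness independent of the sample and of $X$. -/

import Mathlib

open MeasureTheory ProbabilityTheory Filter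
open scoped ENNReal NNReal

namespace DistReg

/-- The covariate space `ℝ^k` with its Euclidean norm. -/
abbrev Cov (k : ℕ) : Type := EuclideanSpace ℝ (Fin k)

/-- The unit cube `[0,1]^k`. -/
def unitCube (k : ℕ) : Set (Cov k) := {x | ∀ j, x j ∈ Set.Icc (0 : ℝ) 1}

/-- `π` is a coupling of `μ` and `ν`, that is, a measure on `ℝ × ℝ` with margins `μ` and `ν`. -/
def IsCoupling (μ ν : Measure ℝ) (π : Measure (ℝ × ℝ)) : Prop :=
  π.fst = μ ∧ π.snd = ν

/-- The Wasserstein distance of order one on the real line, as the minimal transport cost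
over all couplings. -/
noncomputable def W1 (μ ν : Measure ℝ) : ℝ≥0∞ :=
  ⨅ (π : Measure (ℝ × ℝ)) (_ : IsCoupling μ ν π), ∫⁻ y, edist y.1 y.2 ∂π

/-- The class `𝒟(H, L, M)` of distributions `P` of `(X, Y)` on `ℝ^k × ℝ`: `X ∈ [0,1]^k` a.s.,
`Y` is integrable, and there is a version `F` of the conditional distribution of `Y` given `X`
which is `H`-Hölder on the cube in Wasserstein distance with constant `L` and satisfies
`∫ √(F_x (1 - F_x)) ≤ M` for all `x` in the cube. -/
def classD (k : ℕ) (H L M : ℝ) : Set (ProbabilityMeasure (Cov k × ℝ)) :=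
  {P | (∀ᵐ q ∂(P : Measure (Cov k × ℝ)), q.1 ∈ unitCube k) ∧
    Integrable (fun q : Cov k × ℝ => q.2) (P : Measure (Cov k × ℝ)) ∧
    ∃ F : Kernel (Cov k) ℝ, IsMarkovKernel F ∧
      (P : Measure (Cov k × ℝ)) = (P : Measure (Cov k × ℝ)).fst.compProd F ∧
      (∀ x ∈ unitCube k, ∀ x' ∈ unitCube k,
        W1 (F x) (F x') ≤ ENNReal.ofReal (L * ‖x - x'‖ ^ H)) ∧
      (∀ x ∈ unitCube k,
        ∫⁻ z : ℝ, ENNReal.ofReal (Real.sqrt (cdf (F x) z * (1 - cdf (F x) z)))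
          ≤ ENNReal.ofReal M)}

/-- A prediction rule: it maps a sample of size `n` and a point `x` to a measure on `ℝ`, the
predicted conditional distribution of `Y` given `X = x`. -/
abbrev Rule (k n : ℕ) : Type := (Fin n → Cov k × ℝ) × Cov k → Measure ℝ

/-- Estimators are the measurable rules with values in the probability measures. -/
def IsEstimator {k n : ℕ} (G : Rule k n) : Prop :=
  Measurable G ∧ ∀ q, IsProbabilityMeasure (G q)

/-- The risk `𝔼[W₁(F̂_{n,X}, F_X)]`: the sample consists of `n` independent draws from `P`, the
point `X` is drawn from the first margin of `P` independently of the sample, and `F_X` is the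
conditional distribution of `Y` given `X` under `P`. -/
noncomputable def risk {k n : ℕ} (P : ProbabilityMeasure (Cov k × ℝ)) (G : Rule k n) : ℝ≥0∞ :=
  ∫⁻ q, W1 (G q) ((P : Measure (Cov k × ℝ)).condKernel q.2)
    ∂((Measure.pi fun _ : Fin n => (P : Measure (Cov k × ℝ))).prod
      (P : Measure (Cov k × ℝ)).fst)

/-- The worst-case risk of a rule over the class `𝒟(H, L, M)`. -/
noncomputable def maxRisk {k n : ℕ} (H L M : ℝ) (G : Rule k n) : ℝ≥0∞ :=
  ⨆ P ∈ classD k H L M, risk P G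

/-- The worst-case risk over `𝒟(H, L, M)` of a rule which uses auxiliary randomness `t ∼ ν`
independent of the sample and of `X`. -/
noncomputable def maxRiskRand {k n : ℕ} {T : Type} [MeasurableSpace T] (ν : Measure T)
    (H L M : ℝ) (G : T → Rule k n) : ℝ≥0∞ :=
  ⨆ P ∈ classD k H L M, ∫⁻ t, risk P (G t) ∂ν

/-- The minimax risk over `𝒟(H, L, M)` for samples of size `n`. -/
noncomputable def minimaxRisk (k : ℕ) (H L M : ℝ) (n : ℕ) : ℝ≥0∞ :=
  ⨅ (G : Rule k n) (_ : IsEstimator G), maxRisk H L M G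

/-- `a ≍ b`: the ratios `a n / b n` and `b n / a n` remain bounded as `n → ∞`. -/
def SameRate (a b : ℕ → ℝ≥0∞) : Prop :=
  ∃ C : ℝ≥0, ∀ᶠ n in atTop, a n ≤ C * b n ∧ b n ≤ C * a n

/-- The weighted empirical distribution `∑ w_i δ_{y_i}`. -/
noncomputable def weightedEmpirical {n : ℕ} (w : Fin n → ℝ) (y : Fin n → ℝ) : Measure ℝ :=
  ∑ i, ENNReal.ofReal (w i) • Measure.dirac (y i)

/-- Boxed kernels, i.e. measurable `K` with `M₁ 1_{‖x‖ ≤ R₁} ≤ K(x) ≤ M₂ 1_{‖x‖ ≤ R₂}` for some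
`R₂ ≥ R₁ > 0` and `M₂ ≥ M₁ > 0`. -/
def IsBoxedKernel {k : ℕ} (K : Cov k → ℝ) : Prop :=
  Measurable K ∧ ∃ R₁ R₂ M₁ M₂ : ℝ, 0 < R₁ ∧ R₁ ≤ R₂ ∧ 0 < M₁ ∧ M₁ ≤ M₂ ∧
    ∀ x, Set.indicator {x : Cov k | ‖x‖ ≤ R₁} (fun _ => M₁) x ≤ K x ∧
      K x ≤ Set.indicator {x : Cov k | ‖x‖ ≤ R₂} (fun _ => M₂) x

/-- The kernel weights `K((x - X_i)/h) / ∑_j K((x - X_j)/h)`, and `1/n` if the denominator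
vanishes. -/
noncomputable def kernelWeight {k n : ℕ} (K : Cov k → ℝ) (h : ℝ) (xs : Fin n → Cov k)
    (x : Cov k) (i : Fin n) : ℝ :=
  if ∑ j, K (h⁻¹ • (x - xs j)) = 0 then 1 / (n : ℝ)
  else K (h⁻¹ • (x - xs i)) / ∑ j, K (h⁻¹ • (x - xs j))

/-- The kernel method with kernel `K` and bandwidth `h`. -/
noncomputable def kernelRule {k : ℕ} (n : ℕ) (K : Cov k → ℝ) (h : ℝ) : Rule k n :=
  fun q => weightedEmpirical (kernelWeight K h (fun i => (q.1 i).1) q.2) (fun i => (q.1 i).2)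

/-- A rule that selects `κ` nearest neighbours of `x` within `X_1, …, X_n`, with an arbitrary
measurable way of breaking ties that may use `x`, the `X_i` and an auxiliary variable `t`. -/
def IsNNSelection {k n : ℕ} {T : Type} [MeasurableSpace T] (κ : ℕ)
    (S : T × (Fin n → Cov k) × Cov k → Finset (Fin n)) : Prop :=
  (∀ i, MeasurableSet {q | i ∈ S q}) ∧
    ∀ q, (S q).card = κ ∧ ∀ i ∈ S q, ∀ j ∉ S q, ‖q.2.1 i - q.2.2‖ ≤ ‖q.2.1 j - q.2.2‖

/-- The nearest neighbour method: weight `1/κ` on each of the `κ` selected observations, and weight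
zero on the others. -/
noncomputable def nnRule {k n : ℕ} {T : Type} (κ : ℕ)
    (S : T × (Fin n → Cov k) × Cov k → Finset (Fin n)) (t : T) : Rule k n :=
  fun q => weightedEmpirical
    (fun i => if i ∈ S (t, (fun j => (q.1 j).1), q.2) then 1 / (κ : ℝ) else 0)
    (fun i => (q.1 i).2)

end DistReg

namespace DistReg

/-! ### The Wasserstein distance and distribution functions -/

/-! On the line the Wasserstein distance equals the `L¹`-distance of the distribution functions
(`cdfDist_le_W1`, and `W1_le_cdfDist` by the quantile coupling), so errors can be estimated at each
level `z` and then integrated.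

Upper bounds. Write each response as a quantile of its conditional law at an independent uniform
variable. Replacing the law at `X_i` by the law at `x`, with the same uniform, costs a bias
controlled by the Hölder condition. What remains is a weighted empirical distribution function of
independent draws from `F_x`, with variance `∑ w_i² F_x (1 - F_x)` at each level, so its mean error
is at most `√(∑ w_i²) M`. This is `risk_weightRule_le`. Both terms are bounded through the number
`N` of sample points near `x`. Uniformly over all designs on the cube, `lintegral_inv_nearCount_le`
gives `E[1 / (1 + N)] ≤ (m + 1)^k / (n + 1)` at scale `√k / m`, by exchangeability and a pigeonhole
argument on cells. The kernel method needs one scale. The nearest neighbour bias is summed over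
dyadic scales, and that sum is dominated by its finest scale because `k - H ≥ 1`, which is where `k
≥ 2` enters.

Lower bound. Let `X` be uniform on a grid of `m^k` points and `Y ∈ {0, M}`, with success probability
`1/2 ± δ` at each grid point and a Hölder interpolation in between. Flipping one sign changes the
Hellinger affinity of one observation by at most `4δ² / m^k`, so `n` observations cannot determine
that sign if `n δ²` is at most a small multiple of `m^k`. Averaging over all sign patterns
(Assouad's method) yields `le_maxRiskRand`, a bound of order `M δ` with `δ` of order `m^(-H)`.

Both sides balance at the scale `r = n^(-1/(2H+k))`, where `r^H = (n r^k)^(-1/2)`. -/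

/-- The `L¹`-distance of the distribution functions of two measures on the real line. -/
noncomputable def cdfDist (μ ν : Measure ℝ) : ℝ≥0∞ :=
  ∫⁻ z, edist (μ.real (Set.Iic z)) (ν.real (Set.Iic z))

lemma lintegral_edist_indicator_Ici (a b : ℝ) :
    ∫⁻ z, edist ((Set.Ici a).indicator (1 : ℝ → ℝ) z) ((Set.Ici b).indicator 1 z) = edist a b := by
  wlog h : a ≤ b generalizing a b
  · rw [edist_comm a b, ← this b a (le_of_not_ge h)]
    simp_rw [edist_comm]
  have : ∀ z, edist ((Set.Ici a).indicator (1 : ℝ → ℝ) z) ((Set.Ici b).indicator 1 z)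
      = (Set.Ico a b).indicator (1 : ℝ → ℝ≥0∞) z := by
    intro z
    by_cases h1 : a ≤ z <;> by_cases h2 : b ≤ z
    · simp [Set.indicator, h1, h2]
    · simp [Set.indicator, h1, h2, not_le.1 h2, edist_dist]
    · exact absurd (h.trans h2) h1
    · simp [Set.indicator, h1, h2]
  simp_rw [this]
  rw [lintegral_indicator_one measurableSet_Ico, Real.volume_Ico, edist_comm, edist_dist,
    Real.dist_eq, abs_of_nonneg (sub_nonneg.2 h)]

lemma lintegral_edist_indicator_Iic (a b : ℝ) :
    ∫⁻ z, edist ((Set.Iic a).indicator (1 : ℝ → ℝ) z) ((Set.Iic b).indicator 1 z) = edist a b := by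
  wlog h : a ≤ b generalizing a b
  · rw [edist_comm a b, ← this b a (le_of_not_ge h)]
    simp_rw [edist_comm]
  have : ∀ z, edist ((Set.Iic a).indicator (1 : ℝ → ℝ) z) ((Set.Iic b).indicator 1 z)
      = (Set.Ioc a b).indicator (1 : ℝ → ℝ≥0∞) z := by
    intro z
    by_cases h1 : z ≤ a <;> by_cases h2 : z ≤ b
    · simp [Set.indicator, h1, h2]
    · exact absurd (h1.trans h) h2
    · simp [Set.indicator, h1, h2, not_le.1 h1, edist_dist]
    · simp [Set.indicator, h1, h2]
  simp_rw [this]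
  rw [lintegral_indicator_one measurableSet_Ioc, Real.volume_Ioc, edist_comm, edist_dist,
    Real.dist_eq, abs_of_nonneg (sub_nonneg.2 h)]

lemma measurable_indicator_Ici {α : Type*} [MeasurableSpace α] {f g : α → ℝ} (hf : Measurable f)
    (hg : Measurable g) : Measurable fun p => (Set.Ici (f p)).indicator (1 : ℝ → ℝ) (g p) := by
  have : (fun p => (Set.Ici (f p)).indicator (1 : ℝ → ℝ) (g p))
      = {p | f p ≤ g p}.indicator 1 := by
    ext p; simp [Set.indicator]
  rw [this]
  exact measurable_one.indicator (measurableSet_le hf hg)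

/-- Any coupling bounds the distance of the distribution functions. -/
lemma cdfDist_map_le {Ω : Type*} [MeasurableSpace Ω] (ρ : Measure Ω) [IsFiniteMeasure ρ]
    {f g : Ω → ℝ} (hf : Measurable f) (hg : Measurable g) :
    cdfDist (ρ.map f) (ρ.map g) ≤ ∫⁻ ω, edist (f ω) (g ω) ∂ρ := by
  have key : ∀ (h : Ω → ℝ), Measurable h → ∀ z, (ρ.map h).real (Set.Iic z)
      = ∫ ω, (Set.Ici (h ω)).indicator (1 : ℝ → ℝ) z ∂ρ := by
    intro h hh z
    have : (fun ω => (Set.Ici (h ω)).indicator (1 : ℝ → ℝ) z) = (h ⁻¹' Set.Iic z).indicator 1 := by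
      ext ω; simp [Set.indicator]
    rw [this, integral_indicator_one (hh measurableSet_Iic),
      map_measureReal_apply hh measurableSet_Iic]
  have hint : ∀ (h : Ω → ℝ), Measurable h → ∀ z,
      Integrable (fun ω => (Set.Ici (h ω)).indicator (1 : ℝ → ℝ) z) ρ := by
    intro h hh z
    refine Integrable.of_bound
      (measurable_indicator_Ici hh measurable_const).aestronglyMeasurable 1 (ae_of_all _ ?_)
    intro ω
    by_cases hz : h ω ≤ z <;> simp [Set.indicator, hz]
  calc cdfDist (ρ.map f) (ρ.map g)
      ≤ ∫⁻ z, (∫⁻ ω, edist ((Set.Ici (f ω)).indicator (1 : ℝ → ℝ) z)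
          ((Set.Ici (g ω)).indicator 1 z) ∂ρ) := by
        refine lintegral_mono fun z => ?_
        rw [key f hf, key g hg, edist_eq_enorm_sub, ← integral_sub (hint f hf z) (hint g hg z)]
        refine (enorm_integral_le_lintegral_enorm _).trans (le_of_eq ?_)
        simp_rw [edist_eq_enorm_sub]
    _ = ∫⁻ ω, (∫⁻ z, edist ((Set.Ici (f ω)).indicator (1 : ℝ → ℝ) z)
          ((Set.Ici (g ω)).indicator 1 z)) ∂ρ := by
        rw [lintegral_lintegral_swap]
        exact ((measurable_indicator_Ici (hf.comp measurable_snd) measurable_fst).edist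
          (measurable_indicator_Ici (hg.comp measurable_snd) measurable_fst)).aemeasurable
    _ = ∫⁻ ω, edist (f ω) (g ω) ∂ρ := by simp_rw [lintegral_edist_indicator_Ici]

lemma cdfDist_le_W1 (μ ν : Measure ℝ) [IsFiniteMeasure μ] : cdfDist μ ν ≤ W1 μ ν := by
  refine le_iInf₂ fun π hπ => ?_
  obtain ⟨rfl, rfl⟩ := hπ
  have : IsFiniteMeasure π := by
    refine ⟨?_⟩
    have := measure_lt_top π.fst Set.univ
    rwa [Measure.fst_univ] at this
  exact cdfDist_map_le π measurable_fst measurable_snd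

lemma cdfDist_comm (μ ν : Measure ℝ) : cdfDist μ ν = cdfDist ν μ := by
  simp_rw [cdfDist, edist_comm]

lemma measurable_real_Iic (μ : Measure ℝ) [IsFiniteMeasure μ] :
    Measurable fun z => μ.real (Set.Iic z) :=
  Monotone.measurable fun _ _ h => measureReal_mono (Set.Iic_subset_Iic.2 h)

lemma cdfDist_triangle (μ ν ρ : Measure ℝ) [IsFiniteMeasure μ] [IsFiniteMeasure ν] :
    cdfDist μ ρ ≤ cdfDist μ ν + cdfDist ν ρ := by
  unfold cdfDist
  rw [← lintegral_add_left ((measurable_real_Iic μ).edist (measurable_real_Iic ν))]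
  exact lintegral_mono fun z => edist_triangle _ _ _

/-! ### Quantile functions -/

/-- The uniform distribution on the unit interval. -/
noncomputable def unif : Measure ℝ := volume.restrict (Set.Ioo 0 1)

instance : IsProbabilityMeasure unif := ⟨by simp [unif]⟩

open Classical in
/-- The quantile function of a distribution on the real line. -/
noncomputable def quantile (μ : Measure ℝ) (u : ℝ) : ℝ :=
  if u ∈ Set.Ioo (0 : ℝ) 1 then sInf {z | u ≤ μ.real (Set.Iic z)} else 0

/-- Right continuity of the distribution function makes the infimum in `quantile` attained. This
Galois connection is all that is used about quantiles later. -/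
lemma quantile_le_iff (μ : Measure ℝ) [IsProbabilityMeasure μ] {u : ℝ}
    (hu : u ∈ Set.Ioo (0 : ℝ) 1) (z : ℝ) : quantile μ u ≤ z ↔ u ≤ μ.real (Set.Iic z) := by
  rw [quantile, if_pos hu]
  simp_rw [← cdf_eq_real]
  have hbdd : BddBelow {z | u ≤ cdf μ z} := by
    obtain ⟨b, hb⟩ := ((tendsto_cdf_atBot μ).eventually_lt_const hu.1).exists
    refine ⟨b, fun z hz => ?_⟩
    by_contra h
    exact absurd (lt_of_le_of_lt (le_trans hz (monotone_cdf μ (not_le.1 h).le)) hb) (lt_irrefl _)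
  have hne : {z | u ≤ cdf μ z}.Nonempty := by
    obtain ⟨b, hb⟩ := ((tendsto_cdf_atTop μ).eventually_const_lt hu.2).exists
    exact ⟨b, hb.le⟩
  refine ⟨fun h => ?_, fun h => csInf_le hbdd h⟩
  have hlt : ∀ y, z < y → u ≤ cdf μ y := by
    intro y hy
    obtain ⟨w, hw, hwy⟩ := (csInf_lt_iff hbdd hne).1 (lt_of_le_of_lt h hy)
    exact le_trans hw (monotone_cdf μ hwy.le)
  have hc : Tendsto (cdf μ) (nhdsWithin z (Set.Ioi z)) (nhds (cdf μ z)) :=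
    ((cdf μ).right_continuous z).mono_left (nhdsWithin_mono _ Set.Ioi_subset_Ici_self)
  exact ge_of_tendsto hc (eventually_nhdsWithin_of_forall hlt)

lemma measurable_quantile {α : Type*} [MeasurableSpace α] (κ : Kernel α ℝ) [IsMarkovKernel κ] :
    Measurable fun p : α × ℝ => quantile (κ p.1) p.2 := by
  refine measurable_of_Iic fun z => ?_
  have hS : MeasurableSet {p : α × ℝ | p.2 ∈ Set.Ioo (0 : ℝ) 1} :=
    measurable_snd measurableSet_Ioo
  have hk : Measurable fun p : α × ℝ => (κ p.1).real (Set.Iic z) :=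
    ((κ.measurable_coe measurableSet_Iic).comp measurable_fst).ennreal_toReal
  -- The second piece accounts for the default value 0 of `quantile` at levels outside the open unit
  -- interval.
  have : (fun p : α × ℝ => quantile (κ p.1) p.2) ⁻¹' Set.Iic z
      = {p : α × ℝ | p.2 ∈ Set.Ioo (0 : ℝ) 1} ∩ {p | p.2 ≤ (κ p.1).real (Set.Iic z)}
        ∪ {p : α × ℝ | p.2 ∈ Set.Ioo (0 : ℝ) 1}ᶜ ∩ {_p | (0 : ℝ) ≤ z} := by
    ext p
    by_cases hp : p.2 ∈ Set.Ioo (0 : ℝ) 1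
    · simp only [Set.mem_preimage, Set.mem_Iic, quantile_le_iff _ hp, Set.mem_union, Set.mem_inter_iff,
        Set.mem_ofPred_eq, Set.mem_compl_iff, hp, true_and, not_true_eq_false, false_and, or_false]
    · simp only [Set.mem_preimage, Set.mem_Iic, quantile, hp, if_false, Set.mem_union,
        Set.mem_inter_iff, Set.mem_ofPred_eq, Set.mem_compl_iff, false_and, false_or,
        not_false_eq_true, true_and]
  rw [this]
  exact (hS.inter (measurableSet_le measurable_snd hk)).union
    (hS.compl.inter (MeasurableSet.const _))

lemma measurable_quantile_right (μ : Measure ℝ) [IsProbabilityMeasure μ] :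
    Measurable (quantile μ) :=
  (measurable_quantile (Kernel.const Unit μ)).comp (measurable_prodMk_left (x := ()))

lemma map_quantile_unif (μ : Measure ℝ) [IsProbabilityMeasure μ] :
    unif.map (quantile μ) = μ := by
  have : IsProbabilityMeasure (unif.map (quantile μ)) :=
    Measure.isProbabilityMeasure_map (measurable_quantile_right μ).aemeasurable
  refine Measure.ext_of_Iic _ _ fun z => ?_
  rw [Measure.map_apply (measurable_quantile_right μ) measurableSet_Iic, unif,
    Measure.restrict_apply ((measurable_quantile_right μ) measurableSet_Iic)]
  have hset : quantile μ ⁻¹' Set.Iic z ∩ Set.Ioo 0 1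
      = Set.Iic (μ.real (Set.Iic z)) ∩ Set.Ioo 0 1 := by
    ext u
    simp only [Set.mem_inter_iff, Set.mem_preimage, Set.mem_Iic]
    exact and_congr_left fun hu => quantile_le_iff μ hu z
  rw [hset, ← ofReal_measureReal (μ := μ)]
  have h0 : 0 ≤ μ.real (Set.Iic z) := measureReal_nonneg
  have h1 : μ.real (Set.Iic z) ≤ 1 := measureReal_le_one
  refine le_antisymm ?_ ?_
  · refine (measure_mono (t := Set.Ioc 0 (μ.real (Set.Iic z)))
      fun u hu => ⟨hu.2.1, hu.1⟩).trans ?_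
    simp
  · refine le_trans ?_ (measure_mono (s := Set.Ioo 0 (μ.real (Set.Iic z)))
      fun u hu => ⟨hu.2.le, hu.1, hu.2.trans_le h1⟩)
    simp

/-- Write the distance of two quantiles as an integral of step functions in `z` and swap the
integrals. At fixed `z` the Galois connection turns these into steps in `u` at the two values of the
distribution functions, whose integral over the whole line is the distance of those values. -/
lemma lintegral_edist_quantile_le (μ ν : Measure ℝ) [IsProbabilityMeasure μ]
    [IsProbabilityMeasure ν] :
    ∫⁻ u, edist (quantile μ u) (quantile ν u) ∂unif ≤ cdfDist μ ν := by
  calc ∫⁻ u, edist (quantile μ u) (quantile ν u) ∂unif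
      = ∫⁻ u, (∫⁻ z, edist ((Set.Ici (quantile μ u)).indicator (1 : ℝ → ℝ) z)
          ((Set.Ici (quantile ν u)).indicator 1 z)) ∂unif := by
        simp_rw [lintegral_edist_indicator_Ici]
    _ = ∫⁻ z, (∫⁻ u, edist ((Set.Ici (quantile μ u)).indicator (1 : ℝ → ℝ) z)
          ((Set.Ici (quantile ν u)).indicator 1 z) ∂unif) := by
        rw [lintegral_lintegral_swap]
        exact ((measurable_indicator_Ici ((measurable_quantile_right μ).comp measurable_fst)
          measurable_snd).edist (measurable_indicator_Ici
          ((measurable_quantile_right ν).comp measurable_fst) measurable_snd)).aemeasurable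
    _ ≤ cdfDist μ ν := by
        refine lintegral_mono fun z => ?_
        rw [← lintegral_edist_indicator_Iic]
        refine le_trans (le_of_eq ?_) (lintegral_mono' (Measure.restrict_le_self
          (s := Set.Ioo (0 : ℝ) 1)) le_rfl)
        refine setLIntegral_congr_fun measurableSet_Ioo fun u hu => ?_
        simp only [Set.indicator, Set.mem_Ici, Set.mem_Iic, quantile_le_iff _ hu, Pi.one_apply]

/-- The quantile coupling, with one uniform variable driving both margins, is admissible. -/
lemma W1_le_cdfDist (μ ν : Measure ℝ) [IsProbabilityMeasure μ] [IsProbabilityMeasure ν] :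
    W1 μ ν ≤ cdfDist μ ν := by
  refine le_trans ?_ (lintegral_edist_quantile_le μ ν)
  have hm : Measurable fun u => (quantile μ u, quantile ν u) :=
    (measurable_quantile_right μ).prodMk (measurable_quantile_right ν)
  have hc : IsCoupling μ ν (unif.map fun u => (quantile μ u, quantile ν u)) := by
    refine ⟨?_, ?_⟩
    · rw [Measure.fst_map_prodMk (measurable_quantile_right ν), map_quantile_unif]
    · rw [Measure.snd_map_prodMk (measurable_quantile_right μ), map_quantile_unif]
  refine (iInf₂_le _ hc).trans ?_
  rw [lintegral_map (measurable_fst.edist measurable_snd) hm]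

/-! ### The risk of a weighted empirical distribution -/

/-- Nonnegativity of the variance of `|f - E f|` reads `(E |f - E f|)² ≤ Var f`. -/
lemma integral_abs_sub_integral_le {Ω : Type*} [MeasurableSpace Ω] {μ : Measure Ω}
    [IsProbabilityMeasure μ] {f : Ω → ℝ} (hf : MemLp f 2 μ) :
    ∫ ω, |f ω - μ[f]| ∂μ ≤ √Var[f; μ] := by
  have hg : MemLp (fun ω => |f ω - μ[f]|) 2 μ := (hf.sub (memLp_const _)).abs
  have h := variance_nonneg (fun ω => |f ω - μ[f]|) μ
  rw [variance_eq_sub hg] at h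
  have h2 : μ[(fun ω => |f ω - μ[f]|) ^ 2] = Var[f; μ] := by
    rw [variance_eq_integral hf.aestronglyMeasurable.aemeasurable]
    simp
  rw [h2] at h
  exact Real.le_sqrt_of_sq_le (by linarith)

lemma weightedEmpirical_real_Iic {n : ℕ} {w : Fin n → ℝ} (hw : ∀ i, 0 ≤ w i) (y : Fin n → ℝ)
    (z : ℝ) : (weightedEmpirical w y).real (Set.Iic z)
      = ∑ i, w i * (Set.Ici (y i)).indicator (1 : ℝ → ℝ) z := by
  rw [weightedEmpirical, measureReal_def, Measure.finsetSum_apply,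
    ENNReal.toReal_sum (fun i _ => by
      rw [Measure.smul_apply, smul_eq_mul]
      exact ENNReal.mul_ne_top ENNReal.ofReal_ne_top (measure_ne_top _ _))]
  refine Finset.sum_congr rfl fun i _ => ?_
  rw [Measure.smul_apply, smul_eq_mul, ENNReal.toReal_mul, ENNReal.toReal_ofReal (hw i),
    Measure.dirac_apply' _ measurableSet_Iic]
  by_cases h : y i ≤ z <;> simp [Set.indicator, h]

lemma isProbabilityMeasure_weightedEmpirical {n : ℕ} {w : Fin n → ℝ} (hw : ∀ i, 0 ≤ w i)
    (hw1 : ∑ i, w i = 1) (y : Fin n → ℝ) : IsProbabilityMeasure (weightedEmpirical w y) := by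
  refine ⟨?_⟩
  simp only [weightedEmpirical, Measure.finsetSum_apply, Measure.smul_apply, measure_univ,
    smul_eq_mul, mul_one]
  rw [← ENNReal.ofReal_sum_of_nonneg fun i _ => hw i, hw1, ENNReal.ofReal_one]

lemma cdfDist_weightedEmpirical_le {n : ℕ} {w : Fin n → ℝ} (hw : ∀ i, 0 ≤ w i)
    (y y' : Fin n → ℝ) : cdfDist (weightedEmpirical w y) (weightedEmpirical w y')
      ≤ ∑ i, ENNReal.ofReal (w i) * edist (y i) (y' i) := by
  calc cdfDist (weightedEmpirical w y) (weightedEmpirical w y')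
      ≤ ∫⁻ z, ∑ i, ENNReal.ofReal (w i) * edist ((Set.Ici (y i)).indicator (1 : ℝ → ℝ) z)
          ((Set.Ici (y' i)).indicator 1 z) := by
        refine lintegral_mono fun z => ?_
        rw [weightedEmpirical_real_Iic hw, weightedEmpirical_real_Iic hw, edist_eq_enorm_sub,
          ← Finset.sum_sub_distrib]
        refine (enorm_sum_le _ _).trans (Finset.sum_le_sum fun i _ => ?_)
        rw [← mul_sub, enorm_mul, edist_eq_enorm_sub, Real.enorm_of_nonneg (hw i)]
    _ = _ := by
        have hm : ∀ i, Measurable fun z => edist ((Set.Ici (y i)).indicator (1 : ℝ → ℝ) z)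
            ((Set.Ici (y' i)).indicator 1 z) := fun i =>
          (measurable_indicator_Ici measurable_const measurable_id).edist
            (measurable_indicator_Ici measurable_const measurable_id)
        rw [lintegral_finsetSum _ fun i _ => (hm i).const_mul _]
        refine Finset.sum_congr rfl fun i _ => ?_
        rw [lintegral_const_mul _ (hm i), lintegral_edist_indicator_Ici]

lemma integral_indicator_quantile (ν : Measure ℝ) [IsProbabilityMeasure ν] (z : ℝ) :
    ∫ u, (Set.Ici (quantile ν u)).indicator (1 : ℝ → ℝ) z ∂unif = ν.real (Set.Iic z) := by
  have : (fun u => (Set.Ici (quantile ν u)).indicator (1 : ℝ → ℝ) z)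
      = (quantile ν ⁻¹' Set.Iic z).indicator 1 := by
    ext u; simp [Set.indicator]
  rw [this, integral_indicator_one (measurable_quantile_right ν measurableSet_Iic),
    ← map_measureReal_apply (measurable_quantile_right ν) measurableSet_Iic, map_quantile_unif]

/-- The mean fluctuation of a weighted empirical distribution function of independent draws. -/
lemma lintegral_edist_weightedEmpirical_le {n : ℕ} {w : Fin n → ℝ} (hw : ∀ i, 0 ≤ w i)
    (hw1 : ∑ i, w i = 1) (ν : Measure ℝ) [IsProbabilityMeasure ν] (z : ℝ) :
    ∫⁻ u, edist ((weightedEmpirical w fun i => quantile ν (u i)).real (Set.Iic z))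
        (ν.real (Set.Iic z)) ∂(Measure.pi fun _ : Fin n => unif)
      ≤ ENNReal.ofReal (√(∑ i, w i ^ 2)) *
        ENNReal.ofReal (√(cdf ν z * (1 - cdf ν z))) := by
  have hgm : Measurable fun v => (Set.Ici (quantile ν v)).indicator (1 : ℝ → ℝ) z :=
    measurable_indicator_Ici (measurable_quantile_right ν) measurable_const
  have hgL : MemLp (fun v => (Set.Ici (quantile ν v)).indicator (1 : ℝ → ℝ) z) 2 unif := by
    refine MemLp.of_bound hgm.aestronglyMeasurable 1 (ae_of_all _ fun v => ?_)
    by_cases hz : quantile ν v ≤ z <;> simp [Set.indicator, hz]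
  set g : ℝ → ℝ := fun v => (Set.Ici (quantile ν v)).indicator (1 : ℝ → ℝ) z with hg
  have hgE : ∫ v, g v ∂unif = cdf ν z := by
    rw [cdf_eq_real]; exact integral_indicator_quantile ν z
  -- An indicator is its own square, so this is a Bernoulli variance.
  have hgV : Var[g; unif] = cdf ν z * (1 - cdf ν z) := by
    have hsq : g ^ 2 = g := by
      ext v
      by_cases hz : quantile ν v ≤ z <;> simp [hg, Set.indicator, hz]
    rw [variance_eq_sub hgL, hsq, hgE]
    ring
  have hXL : ∀ i, MemLp (fun v => w i * g v) 2 unif := fun i => hgL.const_mul (w i)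
  set f : (Fin n → ℝ) → ℝ := ∑ i, fun u : Fin n → ℝ => w i * g (u i) with hf
  have hfL : MemLp f 2 (Measure.pi fun _ : Fin n => unif) :=
    memLp_finsetSum' _ fun i _ => (hXL i).comp_measurePreserving (measurePreserving_eval _ i)
  have hfV : Var[f; Measure.pi fun _ : Fin n => unif]
      = (∑ i, w i ^ 2) * (cdf ν z * (1 - cdf ν z)) := by
    rw [hf, variance_sum_pi hXL, Finset.sum_mul]
    exact Finset.sum_congr rfl fun i _ => by rw [variance_const_mul, hgV]
  have hfE : ∫ u, f u ∂(Measure.pi fun _ : Fin n => unif) = cdf ν z := by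
    simp only [hf, Finset.sum_apply]
    have hi : ∀ i ∈ Finset.univ, Integrable (fun u : Fin n → ℝ => w i * g (u i))
        (Measure.pi fun _ : Fin n => unif) := fun i _ =>
      ((hXL i).comp_measurePreserving (measurePreserving_eval (fun _ : Fin n => unif) i)).integrable
        (by norm_num)
    rw [integral_finsetSum _ hi]
    have : ∀ i : Fin n, ∫ u, w i * g (u i) ∂(Measure.pi fun _ : Fin n => unif) = w i * cdf ν z := by
      intro i
      rw [integral_comp_eval (μ := fun _ : Fin n => unif) (i := i) (f := fun v => w i * g v)
        (hXL i).aestronglyMeasurable, integral_const_mul, hgE]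
    simp_rw [this]
    rw [← Finset.sum_mul, hw1, one_mul]
  have hff : ∀ u : Fin n → ℝ,
      (weightedEmpirical w fun i => quantile ν (u i)).real (Set.Iic z) = f u := fun u => by
    rw [weightedEmpirical_real_Iic hw, hf, Finset.sum_apply]
  simp_rw [hff, ← cdf_eq_real, edist_dist, Real.dist_eq]
  have hint : Integrable (fun u => |f u - cdf ν z|) (Measure.pi fun _ : Fin n => unif) :=
    ((hfL.integrable (by norm_num)).sub (integrable_const _)).abs
  rw [← ofReal_integral_eq_lintegral_ofReal hint (ae_of_all _ fun _ => abs_nonneg _),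
    ← ENNReal.ofReal_mul (Real.sqrt_nonneg _), ← Real.sqrt_mul (by positivity), ← hfV, ← hfE]
  exact ENNReal.ofReal_le_ofReal (integral_abs_sub_integral_le hfL)

/-- The mean error of a weighted empirical distribution of independent draws from distributions
`m i`, as an estimate of the distribution `ν`. -/
lemma lintegral_W1_weightedEmpirical_le {n : ℕ} {w : Fin n → ℝ} (hw : ∀ i, 0 ≤ w i)
    (hw1 : ∑ i, w i = 1) (m : Fin n → Measure ℝ) [∀ i, IsProbabilityMeasure (m i)]
    (ν : Measure ℝ) [IsProbabilityMeasure ν] :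
    ∫⁻ u, W1 (weightedEmpirical w fun i => quantile (m i) (u i)) ν
        ∂(Measure.pi fun _ : Fin n => unif)
      ≤ ∑ i, ENNReal.ofReal (w i) * cdfDist (m i) ν + ENNReal.ofReal (√(∑ i, w i ^ 2)) *
        ∫⁻ z, ENNReal.ofReal (√(cdf ν z * (1 - cdf ν z))) := by
  have hqm : ∀ i, Measurable fun u : Fin n → ℝ => edist (quantile (m i) (u i)) (quantile ν (u i)) :=
    fun i => ((measurable_quantile_right (m i)).comp (measurable_pi_apply i)).edist
      ((measurable_quantile_right ν).comp (measurable_pi_apply i))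
  -- Insert the weighted empirical distribution of the quantiles of `ν` at the same uniforms: one
  -- side of it is bias, the other pure fluctuation.
  calc ∫⁻ u, W1 (weightedEmpirical w fun i => quantile (m i) (u i)) ν
        ∂(Measure.pi fun _ : Fin n => unif)
      ≤ ∫⁻ u, (∑ i, ENNReal.ofReal (w i) * edist (quantile (m i) (u i)) (quantile ν (u i))
          + cdfDist (weightedEmpirical w fun i => quantile ν (u i)) ν)
          ∂(Measure.pi fun _ : Fin n => unif) := by
        refine lintegral_mono fun u => ?_
        have h1 := isProbabilityMeasure_weightedEmpirical hw hw1 fun i => quantile (m i) (u i)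
        have h2 := isProbabilityMeasure_weightedEmpirical hw hw1 fun i => quantile ν (u i)
        refine (W1_le_cdfDist _ _).trans ((cdfDist_triangle _
          (weightedEmpirical w fun i => quantile ν (u i)) _).trans ?_)
        gcongr
        exact cdfDist_weightedEmpirical_le hw _ _
    _ = ∑ i, ENNReal.ofReal (w i) * ∫⁻ v, edist (quantile (m i) v) (quantile ν v) ∂unif
          + ∫⁻ u, cdfDist (weightedEmpirical w fun i => quantile ν (u i)) ν
          ∂(Measure.pi fun _ : Fin n => unif) := by
        rw [lintegral_add_left (Finset.measurable_sum _ fun i _ => (hqm i).const_mul _),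
          lintegral_finsetSum _ fun i _ => (hqm i).const_mul _]
        congr 1
        refine Finset.sum_congr rfl fun i _ => ?_
        rw [lintegral_const_mul _ (hqm i)]
        congr 1
        exact (measurePreserving_eval (fun _ : Fin n => unif) i).lintegral_comp
          ((measurable_quantile_right (m i)).edist (measurable_quantile_right ν))
    _ ≤ _ := by
        gcongr with i
        · exact lintegral_edist_quantile_le _ _
        · unfold cdfDist
          rw [lintegral_lintegral_swap]
          · rw [← lintegral_const_mul']
            · exact lintegral_mono fun z => lintegral_edist_weightedEmpirical_le hw hw1 ν z
            · exact ENNReal.ofReal_ne_top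
          · refine Measurable.aemeasurable ?_
            refine Measurable.edist ?_ ((measurable_real_Iic ν).comp measurable_snd)
            simp_rw [weightedEmpirical_real_Iic hw]
            exact Finset.measurable_sum _ fun i _ => (measurable_indicator_Ici
              ((measurable_quantile_right ν).comp ((measurable_pi_apply i).comp measurable_fst))
              measurable_snd).const_mul _

/-- A disintegrated law is generated by the conditional quantile functions. -/
lemma compProd_eq_map_quantile {α : Type*} [MeasurableSpace α] (μ : Measure α) [SFinite μ]
    (F : Kernel α ℝ) [IsMarkovKernel F] :
    μ.compProd F = (μ.prod unif).map fun p => (p.1, quantile (F p.1) p.2) := by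
  have hm : Measurable fun p : α × ℝ => (p.1, quantile (F p.1) p.2) :=
    measurable_fst.prodMk (measurable_quantile F)
  ext s hs
  rw [Measure.compProd_apply hs, Measure.map_apply hm hs, Measure.prod_apply (hm hs)]
  refine lintegral_congr fun a => ?_
  conv_lhs => rw [← map_quantile_unif (F a)]
  rw [Measure.map_apply (measurable_quantile_right _) (measurable_prodMk_left hs)]
  rfl

lemma measurableSet_unitCube (k : ℕ) : MeasurableSet (unitCube k) := by
  have : unitCube k = ⋂ j, {x : Cov k | x j ∈ Set.Icc (0 : ℝ) 1} := by
    ext x; simp [unitCube]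
  rw [this]
  exact MeasurableSet.iInter fun j => (by fun_prop : Measurable fun x : Cov k => x j)
    measurableSet_Icc

lemma ae_fst_mem_unitCube {k : ℕ} {H L M : ℝ} {P : ProbabilityMeasure (Cov k × ℝ)}
    (hP : P ∈ classD k H L M) : ∀ᵐ x ∂(P : Measure (Cov k × ℝ)).fst, x ∈ unitCube k :=
  (ae_map_iff measurable_fst.aemeasurable (measurableSet_unitCube k)).2 hP.1

/-- The rule that puts weights `w` on the observed responses. -/
noncomputable def weightRule {k n : ℕ} (w : (Fin n → Cov k) → Cov k → Fin n → ℝ) : Rule k n :=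
  fun q => weightedEmpirical (w (fun i => (q.1 i).1) q.2) fun i => (q.1 i).2

/-- The conditional bias-variance bound for rules with nonnegative weights. -/
lemma risk_weightRule_le {k n : ℕ} {H L M : ℝ} (hL : 0 ≤ L) (hM : 0 ≤ M)
    {P : ProbabilityMeasure (Cov k × ℝ)}
    (hP : P ∈ classD k H L M) {w : (Fin n → Cov k) → Cov k → Fin n → ℝ}
    (hw : ∀ xs x i, 0 ≤ w xs x i) (hw1 : ∀ xs x, ∑ i, w xs x i = 1)
    {B : (Fin n → Cov k) × Cov k → ℝ≥0∞} (hBm : Measurable B)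
    (hB : ∀ xs x, (∀ i, xs i ∈ unitCube k) → x ∈ unitCube k →
      ENNReal.ofReal (L * ∑ i, w xs x i * ‖xs i - x‖ ^ H + √(∑ i, w xs x i ^ 2) * M)
        ≤ B (xs, x)) :
    risk P (weightRule w) ≤ ∫⁻ q, B q ∂((Measure.pi fun _ : Fin n =>
      (P : Measure (Cov k × ℝ)).fst).prod (P : Measure (Cov k × ℝ)).fst) := by
  have hXμ := ae_fst_mem_unitCube hP
  obtain ⟨-, -, F, hF, hPF, hHol, hFM⟩ := hP
  set μ := (P : Measure (Cov k × ℝ)).fst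
  -- The risk refers to `condKernel`, the class to some version `F`; they agree almost everywhere.
  have hcond : ∀ᵐ x ∂μ, F x = (P : Measure (Cov k × ℝ)).condKernel x :=
    eq_condKernel_of_measure_eq_compProd F hPF
  set qm : Cov k × ℝ → Cov k × ℝ := fun p => (p.1, quantile (F p.1) p.2) with hqm
  have hqmm : Measurable qm := measurable_fst.prodMk (measurable_quantile F)
  have hPmap : (P : Measure (Cov k × ℝ)) = (μ.prod unif).map qm := by
    rw [← compProd_eq_map_quantile]; exact hPF
  have hpi : (Measure.pi fun _ : Fin n => (P : Measure (Cov k × ℝ)))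
      = (Measure.pi fun _ : Fin n => μ.prod unif).map fun s i => qm (s i) := by
    have : IsProbabilityMeasure ((μ.prod unif).map qm) :=
      Measure.isProbabilityMeasure_map hqmm.aemeasurable
    rw [Measure.pi_map_pi (f := fun _ : Fin n => qm) fun _ => hqmm.aemeasurable, ← hPmap]
  have hsplit : (Measure.pi fun _ : Fin n => μ.prod unif)
      = ((Measure.pi fun _ : Fin n => μ).prod (Measure.pi fun _ : Fin n => unif)).map
        (MeasurableEquiv.arrowProdEquivProdArrow (Cov k) ℝ (Fin n)).symm :=
    ((measurePreserving_arrowProdEquivProdArrow (Cov k) ℝ (Fin n) (fun _ => μ)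
      (fun _ => unif)).symm _).map_eq.symm
  -- The sample is an image of independent covariates and independent uniforms, so fixing the
  -- covariates leaves only uniforms to integrate.
  have hpi2 : (Measure.pi fun _ : Fin n => (P : Measure (Cov k × ℝ)))
      = ((Measure.pi fun _ : Fin n => μ).prod (Measure.pi fun _ : Fin n => unif)).map
        fun p i => (p.1 i, quantile (F (p.1 i)) (p.2 i)) := by
    have hm : Measurable fun (s : Fin n → Cov k × ℝ) i => qm (s i) :=
      measurable_pi_lambda _ fun i => hqmm.comp (measurable_pi_apply i)
    rw [hpi, hsplit, Measure.map_map hm (MeasurableEquiv.measurable _)]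
    rfl
  have hcube : ∀ᵐ xs ∂(Measure.pi fun _ : Fin n => μ), ∀ i, xs i ∈ unitCube k :=
    ae_all_iff.2 fun i => (Measure.quasiMeasurePreserving_eval (μ := fun _ : Fin n => μ) i).ae hXμ
  unfold risk
  -- `lintegral_map_le` and `lintegral_prod_le` are inequalities valid for arbitrary integrands, so
  -- the measurability of `W1`, an infimum over couplings, is never needed.
  calc _ ≤ ∫⁻ x, ∫⁻ s, W1 (weightRule w (s, x)) ((P : Measure (Cov k × ℝ)).condKernel x)
          ∂(Measure.pi fun _ : Fin n => (P : Measure (Cov k × ℝ))) ∂μ := by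
        rw [← Measure.prod_swap]
        exact (lintegral_map_le _ _).trans (lintegral_prod_le _)
    _ ≤ ∫⁻ x, ∫⁻ xs, B (xs, x) ∂(Measure.pi fun _ : Fin n => μ) ∂μ := by
        refine lintegral_mono_ae ?_
        filter_upwards [hXμ, hcond] with x hx hFx
        rw [← hFx, hpi2]
        refine (lintegral_map_le _ _).trans ((lintegral_prod_le _).trans (lintegral_mono_ae ?_))
        filter_upwards [hcube] with xs hxs
        refine le_trans ?_ (hB xs x hxs hx)
        refine (lintegral_W1_weightedEmpirical_le (hw xs x) (hw1 xs x) (fun i => F (xs i))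
          (F x)).trans ?_
        have hs : ∀ i, 0 ≤ w xs x i * ‖xs i - x‖ ^ H := fun i =>
          mul_nonneg (hw xs x i) (by positivity)
        rw [ENNReal.ofReal_add (mul_nonneg hL (Finset.sum_nonneg fun i _ => hs i)) (by positivity),
          ENNReal.ofReal_mul (Real.sqrt_nonneg _), Finset.mul_sum,
          ENNReal.ofReal_sum_of_nonneg fun i _ => mul_nonneg hL (hs i)]
        gcongr with i
        · rw [mul_left_comm, ENNReal.ofReal_mul (hw xs x i)]
          gcongr
          exact (cdfDist_le_W1 _ _).trans (hHol _ (hxs i) _ hx)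
        · exact hFM x hx
    _ = _ := by
        rw [lintegral_prod_symm' _ hBm]

/-! ### Counting near neighbours -/

/-- The number of points `xs i` at distance at most `ε` from `x`. -/
noncomputable def nearCount {k n : ℕ} (ε : ℝ) (xs : Fin n → Cov k) (x : Cov k) : ℕ :=
  (Finset.univ.filter fun i => ‖xs i - x‖ ≤ ε).card

lemma measurable_nearCount {k n : ℕ} (ε : ℝ) :
    Measurable fun q : (Fin n → Cov k) × Cov k => nearCount ε q.1 q.2 := by
  simp only [nearCount, Finset.card_filter]
  refine Finset.measurable_sum _ fun i _ => Measurable.ite ?_ measurable_const measurable_const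
  exact measurableSet_le (by fun_prop) measurable_const

/-- The offset `c` is 1 for a new point outside the sample, and 0 for a point that already counts
itself. -/
lemma measurable_inv_nearCount {k n : ℕ} (ε : ℝ) (c : ℕ) :
    Measurable fun q : (Fin n → Cov k) × Cov k => ((c + nearCount ε q.1 q.2 : ℕ) : ℝ≥0∞)⁻¹ := by
  have h : Measurable fun j : ℕ => ((c + j : ℕ) : ℝ≥0∞)⁻¹ := Measurable.of_discrete
  exact h.comp (measurable_nearCount ε)

lemma norm_sub_le_of_coord {k : ℕ} {x y : Cov k} {c : ℝ} (hc : 0 ≤ c)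
    (h : ∀ j, |x j - y j| ≤ c) : ‖x - y‖ ≤ √k * c := by
  rw [EuclideanSpace.norm_eq]
  refine Real.sqrt_le_iff.2 ⟨by positivity, ?_⟩
  rw [mul_pow, Real.sq_sqrt (Nat.cast_nonneg k)]
  calc ∑ j, ‖(x - y) j‖ ^ 2 ≤ ∑ _j : Fin k, c ^ 2 := by
        refine Finset.sum_le_sum fun j _ => ?_
        have := h j
        rw [PiLp.sub_apply, Real.norm_eq_abs]
        gcongr
    _ = k * c ^ 2 := by simp

lemma norm_sub_le_of_mem_unitCube {k : ℕ} {x y : Cov k} (hx : x ∈ unitCube k)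
    (hy : y ∈ unitCube k) : ‖x - y‖ ≤ √k := by
  have := norm_sub_le_of_coord (x := x) (y := y) zero_le_one fun j => by
    have h1 := hx j; have h2 := hy j
    exact abs_le.2 ⟨by linarith [h1.1, h2.2], by linarith [h1.2, h2.1]⟩
  simpa using this

/-- Points whose scaled coordinates have the same integer parts lie within `√k / m` of each other,
so the reciprocals over one such cell sum to at most 1. There are `m + 1` integer parts per
coordinate, since the coordinate 1 gives `m`. -/
lemma sum_inv_nearCount_le {k N m : ℕ} (hm : 1 ≤ m) (z : Fin N → Cov k)
    (hz : ∀ i, z i ∈ unitCube k) :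
    ∑ i, ((nearCount (√k / m) z (z i) : ℕ) : ℝ≥0∞)⁻¹ ≤ ((m : ℝ≥0∞) + 1) ^ k := by
  have hm0 : (0 : ℝ) < m := by exact_mod_cast hm
  have hlt : ∀ i j, ⌊(m : ℝ) * z i j⌋₊ < m + 1 := fun i j => by
    refine Nat.lt_succ_of_le (Nat.floor_le_of_le ?_)
    exact mul_le_of_le_one_right hm0.le (hz i j).2
  let c : Fin N → (Fin k → Fin (m + 1)) := fun i j => ⟨⌊(m : ℝ) * z i j⌋₊, hlt i j⟩
  have hc : ∀ i i', c i' = c i → ‖z i' - z i‖ ≤ √k / m := by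
    intro i i' h
    rw [div_eq_mul_one_div]
    refine norm_sub_le_of_coord (by positivity) fun j => ?_
    have hj : ⌊(m : ℝ) * z i' j⌋₊ = ⌊(m : ℝ) * z i j⌋₊ := congrArg Fin.val (congrFun h j)
    have a1 := Nat.floor_le (mul_nonneg hm0.le (hz i j).1)
    have a2 := Nat.floor_le (mul_nonneg hm0.le (hz i' j).1)
    have a3 := Nat.lt_floor_add_one ((m : ℝ) * z i j)
    have a4 := Nat.lt_floor_add_one ((m : ℝ) * z i' j)
    rw [hj] at a2 a4
    rw [le_div_iff₀ hm0, ← abs_of_pos hm0, ← abs_mul]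
    exact abs_le.2 ⟨by linarith, by linarith⟩
  calc ∑ i, ((nearCount (√k / m) z (z i) : ℕ) : ℝ≥0∞)⁻¹
      ≤ ∑ i, (((Finset.univ.filter fun i' => c i' = c i).card : ℕ) : ℝ≥0∞)⁻¹ := by
        refine Finset.sum_le_sum fun i _ => ENNReal.inv_le_inv.2 ?_
        exact_mod_cast Finset.card_le_card
          (Finset.monotone_filter_right _ fun i' _ h => hc i i' h)
    _ = ∑ v, ∑ i with c i = v,
          (((Finset.univ.filter fun i' => c i' = c i).card : ℕ) : ℝ≥0∞)⁻¹ :=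
        (Finset.sum_fiberwise _ _ _).symm
    _ ≤ ∑ _v : Fin k → Fin (m + 1), 1 := by
        refine Finset.sum_le_sum fun v _ => ?_
        rw [Finset.sum_congr rfl (g := fun _ =>
          (((Finset.univ.filter fun i' => c i' = v).card : ℕ) : ℝ≥0∞)⁻¹) fun i hi => by
            rw [(Finset.mem_filter.1 hi).2], Finset.sum_const, nsmul_eq_mul]
        -- The inequality form also covers empty cells, where the product is `0 * ⊤ = 0`.
        exact ENNReal.mul_inv_le_one _
    _ = ((m : ℝ≥0∞) + 1) ^ k := by simp

/-- By exchangeability, a new point has few sample points in its neighbourhood only rarely,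
whatever the distribution on the cube. -/
lemma lintegral_inv_nearCount_le {k n m : ℕ} (hm : 1 ≤ m) (μ : Measure (Cov k))
    [IsProbabilityMeasure μ] (hμ : ∀ᵐ x ∂μ, x ∈ unitCube k) :
    ∫⁻ q, ((1 + nearCount (√k / m) q.1 q.2 : ℕ) : ℝ≥0∞)⁻¹ ∂((Measure.pi fun _ : Fin n => μ).prod μ)
      ≤ ((m : ℝ≥0∞) + 1) ^ k / (n + 1) := by
  set T : (Fin n → Cov k) × Cov k → ℝ≥0∞ :=
    fun q => ((1 + nearCount (√k / m) q.1 q.2 : ℕ) : ℝ≥0∞)⁻¹ with hT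
  have hTm : Measurable T := measurable_inv_nearCount _ 1
  have hzm : ∀ i : Fin (n + 1), Measurable fun z : Fin (n + 1) → Cov k =>
      ((nearCount (√k / m) z (z i) : ℕ) : ℝ≥0∞)⁻¹ := by
    intro i
    have h1 : Measurable fun z : Fin (n + 1) → Cov k => (z, z i) :=
      measurable_id.prodMk (measurable_pi_apply i)
    have h2 := (measurable_inv_nearCount (√k / m) 0).comp h1
    simpa only [Function.comp_def, zero_add] using h2
  -- Any one of `n + 1` independent points can play the new point; that it counts itself explains
  -- the `1 +` in `T`.
  have hi : ∀ i : Fin (n + 1), ∫⁻ q, T q ∂((Measure.pi fun _ : Fin n => μ).prod μ)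
      = ∫⁻ z, ((nearCount (√k / m) z (z i) : ℕ) : ℝ≥0∞)⁻¹
        ∂(Measure.pi fun _ : Fin (n + 1) => μ) := by
    intro i
    have h1 : ∫⁻ z, T ((fun j => z (i.succAbove j)), z i) ∂(Measure.pi fun _ : Fin (n + 1) => μ)
        = ∫⁻ p, T (p.2, p.1) ∂(μ.prod (Measure.pi fun _ : Fin n => μ)) :=
      (measurePreserving_piFinSuccAbove (fun _ : Fin (n + 1) => μ) i).lintegral_comp
        (f := fun p => T (p.2, p.1)) (hTm.comp measurable_swap)
    rw [← Measure.prod_swap, lintegral_map hTm measurable_swap]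
    refine h1.symm.trans (lintegral_congr fun z => ?_)
    have : nearCount (√k / m) z (z i)
        = 1 + nearCount (√k / m) (fun j => z (i.succAbove j)) (z i) := by
      have h0 : ‖z i - z i‖ ≤ √k / m := by rw [sub_self, norm_zero]; positivity
      simp only [nearCount, Finset.card_filter, Fin.sum_univ_succAbove _ i, if_pos h0]
    rw [this]
  have hae : ∀ᵐ z ∂(Measure.pi fun _ : Fin (n + 1) => μ), ∀ i, z i ∈ unitCube k :=
    ae_all_iff.2 fun i =>
      (Measure.quasiMeasurePreserving_eval (μ := fun _ : Fin (n + 1) => μ) i).ae hμ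
  rw [ENNReal.le_div_iff_mul_le (Or.inl (by positivity)) (Or.inl (by finiteness))]
  calc (∫⁻ q, T q ∂((Measure.pi fun _ : Fin n => μ).prod μ)) * (n + 1)
      = ∑ _i : Fin (n + 1), ∫⁻ q, T q ∂((Measure.pi fun _ : Fin n => μ).prod μ) := by
        simp [mul_comm]
    _ = ∑ i : Fin (n + 1), ∫⁻ z, ((nearCount (√k / m) z (z i) : ℕ) : ℝ≥0∞)⁻¹
          ∂(Measure.pi fun _ : Fin (n + 1) => μ) := Finset.sum_congr rfl fun i _ => hi i
    _ = ∫⁻ z, ∑ i : Fin (n + 1), ((nearCount (√k / m) z (z i) : ℕ) : ℝ≥0∞)⁻¹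
          ∂(Measure.pi fun _ : Fin (n + 1) => μ) :=
        (lintegral_finsetSum _ fun i _ => hzm i).symm
    _ ≤ ∫⁻ _z, ((m : ℝ≥0∞) + 1) ^ k ∂(Measure.pi fun _ : Fin (n + 1) => μ) := by
        refine lintegral_mono_ae ?_
        filter_upwards [hae] with z hz using sum_inv_nearCount_le hm z hz
    _ = ((m : ℝ≥0∞) + 1) ^ k := by simp

/-- Bounds affine in the reciprocal counts integrate term by term. The kernel method uses a single
scale, the nearest neighbour method a range of dyadic ones. -/
lemma lintegral_sum_inv_nearCount_le {k n : ℕ} {ι : Type*} (s : Finset ι) {m : ι → ℕ}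
    (hm : ∀ j, 1 ≤ m j) {a : ℝ} (ha : 0 ≤ a) {b : ι → ℝ} (hb : ∀ j, 0 ≤ b j)
    (μ : Measure (Cov k)) [IsProbabilityMeasure μ] (hμ : ∀ᵐ x ∂μ, x ∈ unitCube k) :
    ∫⁻ q, ENNReal.ofReal (a + ∑ j ∈ s, b j * (1 + (nearCount (√k / m j) q.1 q.2 : ℝ))⁻¹)
        ∂((Measure.pi fun _ : Fin n => μ).prod μ)
      ≤ ENNReal.ofReal (a + ∑ j ∈ s, b j * (((m j : ℝ) + 1) ^ k / (n + 1))) := by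
  have hTm : ∀ j, Measurable fun q : (Fin n → Cov k) × Cov k =>
      ((1 + nearCount (√k / m j) q.1 q.2 : ℕ) : ℝ≥0∞)⁻¹ := fun j =>
    measurable_inv_nearCount _ 1
  have hpt : ∀ q : (Fin n → Cov k) × Cov k,
      ENNReal.ofReal (a + ∑ j ∈ s, b j * (1 + (nearCount (√k / m j) q.1 q.2 : ℝ))⁻¹)
      = ENNReal.ofReal a + ∑ j ∈ s, ENNReal.ofReal (b j) *
        ((1 + nearCount (√k / m j) q.1 q.2 : ℕ) : ℝ≥0∞)⁻¹ := by
    intro q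
    have h0 : ∀ j ∈ s, 0 ≤ b j * (1 + (nearCount (√k / m j) q.1 q.2 : ℝ))⁻¹ := fun j _ =>
      mul_nonneg (hb j) (by positivity)
    rw [ENNReal.ofReal_add ha (Finset.sum_nonneg h0), ENNReal.ofReal_sum_of_nonneg h0]
    congr 1
    refine Finset.sum_congr rfl fun j _ => ?_
    rw [ENNReal.ofReal_mul (hb j), ENNReal.ofReal_inv_of_pos (by positivity)]
    congr 2
    rw [← ENNReal.ofReal_natCast]
    push_cast
    rfl
  simp_rw [hpt]
  rw [lintegral_add_left measurable_const,
    lintegral_finsetSum _ fun j _ => (hTm j).const_mul _]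
  have h0 : ∀ j ∈ s, 0 ≤ b j * (((m j : ℝ) + 1) ^ k / (n + 1)) := fun j _ =>
    mul_nonneg (hb j) (by positivity)
  rw [ENNReal.ofReal_add ha (Finset.sum_nonneg h0), ENNReal.ofReal_sum_of_nonneg h0,
    lintegral_const, measure_univ, mul_one]
  gcongr with j hj
  rw [lintegral_const_mul _ (hTm j), ENNReal.ofReal_mul (hb j)]
  gcongr
  refine (lintegral_inv_nearCount_le (hm j) μ hμ).trans (le_of_eq ?_)
  rw [ENNReal.ofReal_div_of_pos (by positivity), ENNReal.ofReal_pow (by positivity),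
    ENNReal.ofReal_add (by positivity) zero_le_one, ENNReal.ofReal_add (by positivity) zero_le_one,
    ENNReal.ofReal_natCast, ENNReal.ofReal_natCast, ENNReal.ofReal_one]

/-! ### Risk bounds for the kernel method -/

lemma sum_mul_rpow_le {n k : ℕ} {H c : ℝ} (hH : 0 ≤ H) {w : Fin n → ℝ} (hw : ∀ i, 0 ≤ w i)
    (hw1 : ∑ i, w i = 1) {xs : Fin n → Cov k} {x : Cov k}
    (h : ∀ i, w i ≠ 0 → ‖xs i - x‖ ≤ c) : ∑ i, w i * ‖xs i - x‖ ^ H ≤ c ^ H := by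
  calc ∑ i, w i * ‖xs i - x‖ ^ H ≤ ∑ i, w i * c ^ H := by
        refine Finset.sum_le_sum fun i _ => ?_
        by_cases hi : w i = 0
        · simp [hi]
        · exact mul_le_mul_of_nonneg_left
            (Real.rpow_le_rpow (norm_nonneg _) (h i hi) hH) (hw i)
    _ = c ^ H := by rw [← Finset.sum_mul, hw1, one_mul]

lemma sum_sq_le_of_le {n : ℕ} {w : Fin n → ℝ} (hw : ∀ i, 0 ≤ w i) (hw1 : ∑ i, w i = 1) {c : ℝ}
    (h : ∀ i, w i ≤ c) : ∑ i, w i ^ 2 ≤ c := by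
  calc ∑ i, w i ^ 2 ≤ ∑ i, c * w i :=
        Finset.sum_le_sum fun i _ => by rw [sq]; exact mul_le_mul_of_nonneg_right (h i) (hw i)
    _ = c := by rw [← Finset.mul_sum, hw1, mul_one]

lemma IsBoxedKernel.nonneg {k : ℕ} {K : Cov k → ℝ} (hK : IsBoxedKernel K) (x : Cov k) :
    0 ≤ K x := by
  obtain ⟨-, R₁, R₂, M₁, M₂, -, -, hM₁, -, h⟩ := hK
  exact (Set.indicator_nonneg (fun _ _ => hM₁.le) x).trans (h x).1

lemma kernelWeight_nonneg {k n : ℕ} {K : Cov k → ℝ} (hK : ∀ x, 0 ≤ K x) (h : ℝ)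
    (xs : Fin n → Cov k) (x : Cov k) (i : Fin n) : 0 ≤ kernelWeight K h xs x i := by
  unfold kernelWeight
  split_ifs
  · positivity
  · exact div_nonneg (hK _) (Finset.sum_nonneg fun j _ => hK _)

lemma sum_kernelWeight {k n : ℕ} (hn : 1 ≤ n) (K : Cov k → ℝ) (h : ℝ)
    (xs : Fin n → Cov k) (x : Cov k) : ∑ i, kernelWeight K h xs x i = 1 := by
  have hn0 : (n : ℝ) ≠ 0 := by positivity
  unfold kernelWeight
  split_ifs with h0
  · simp [hn0]
  · rw [← Finset.sum_div, div_self h0]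

/-- The ball of radius `√k / m` fits into the inner box, so each of the `N` points in it adds at
least `M₁` to the denominator, while the outer box confines the positive weights to distance `R₂ *
h`. The fallback weights occur only if `N = 0`; their bias, at most `√k ^ H`, is then absorbed by
the factor `√(1 / (1 + N)) = 1`. -/
lemma risk_kernelRule_le {k n m : ℕ} (hn : 1 ≤ n) (hm : 1 ≤ m) {H L M : ℝ} (hH : 0 < H)
    (hL : 0 < L) (hM : 0 < M) {K : Cov k → ℝ} (hK : Measurable K) {R₁ R₂ M₁ M₂ : ℝ}
    (hR : R₁ ≤ R₂) (hR₁ : 0 < R₁) (hM₁ : 0 < M₁) (hM₂ : M₁ ≤ M₂)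
    (hbox : ∀ x, Set.indicator {x : Cov k | ‖x‖ ≤ R₁} (fun _ => M₁) x ≤ K x ∧
      K x ≤ Set.indicator {x : Cov k | ‖x‖ ≤ R₂} (fun _ => M₂) x)
    {h : ℝ} (hh : 0 < h) (hmh : √k / m ≤ R₁ * h)
    {P : ProbabilityMeasure (Cov k × ℝ)} (hP : P ∈ classD k H L M) :
    risk P (kernelRule n K h) ≤ ENNReal.ofReal (L * (R₂ * h) ^ H +
      (L * √k ^ H + √(2 * M₂ / M₁) * M) * √(((m : ℝ) + 1) ^ k / (n + 1))) := by
  have hM₂0 : 0 < M₂ := hM₁.trans_le hM₂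
  have hK0 : ∀ x, 0 ≤ K x := IsBoxedKernel.nonneg ⟨hK, R₁, R₂, M₁, M₂, hR₁, hR, hM₁, hM₂, hbox⟩
  set s : ℝ := √(((m : ℝ) + 1) ^ k / (n + 1)) with hs
  have hs0 : 0 < s := Real.sqrt_pos.2 (by positivity)
  have hs2 : s ^ 2 = ((m : ℝ) + 1) ^ k / (n + 1) := Real.sq_sqrt (by positivity)
  set D : ℝ := L * √k ^ H + √(2 * M₂ / M₁) * M with hD
  have hD0 : 0 ≤ D := by positivity
  have hR₂ : 0 ≤ R₂ := hR₁.le.trans hR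
  have hw0 := kernelWeight_nonneg (n := n) hK0 h
  have hw1 := sum_kernelWeight hn K h
  have main : ∀ (xs : Fin n → Cov k) (x : Cov k), (∀ i, xs i ∈ unitCube k) → x ∈ unitCube k →
      L * ∑ i, kernelWeight K h xs x i * ‖xs i - x‖ ^ H
        + √(∑ i, kernelWeight K h xs x i ^ 2) * M
        ≤ L * (R₂ * h) ^ H + D * √((1 + (nearCount (√k / m) xs x : ℝ))⁻¹) := by
    intro xs x hxs hx
    set N := nearCount (√k / m) xs x with hN
    have hnorm : ∀ i, ‖h⁻¹ • (x - xs i)‖ = h⁻¹ * ‖xs i - x‖ := fun i => by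
      rw [norm_smul, norm_inv, Real.norm_of_nonneg hh.le, norm_sub_rev]
    have hKge : ∀ i, ‖xs i - x‖ ≤ √k / m → M₁ ≤ K (h⁻¹ • (x - xs i)) := by
      intro i hi
      have hmem : h⁻¹ • (x - xs i) ∈ {x : Cov k | ‖x‖ ≤ R₁} := by
        change ‖h⁻¹ • (x - xs i)‖ ≤ R₁
        rw [hnorm, inv_mul_le_iff₀ hh, mul_comm]
        exact hi.trans hmh
      have := (hbox (h⁻¹ • (x - xs i))).1
      rwa [Set.indicator_of_mem hmem] at this
    have hKle : ∀ y, K y ≤ M₂ := fun y =>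
      (hbox y).2.trans (Set.indicator_le_self' (fun _ _ => hM₂0.le) y)
    have hS : N * M₁ ≤ ∑ j, K (h⁻¹ • (x - xs j)) := by
      calc (N : ℝ) * M₁ = ∑ j with ‖xs j - x‖ ≤ √k / m, M₁ := by
            rw [Finset.sum_const, nsmul_eq_mul, hN, nearCount]
        _ ≤ ∑ j with ‖xs j - x‖ ≤ √k / m, K (h⁻¹ • (x - xs j)) :=
            Finset.sum_le_sum fun j hj => hKge j (Finset.mem_filter.1 hj).2
        _ ≤ ∑ j, K (h⁻¹ • (x - xs j)) :=
            Finset.sum_le_sum_of_subset_of_nonneg (Finset.filter_subset _ _) fun j _ _ => hK0 _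
    have hN1 : N = 0 ∨ (1 : ℝ) ≤ N := by
      rcases Nat.eq_zero_or_pos N with h0 | h0
      · exact Or.inl h0
      · exact Or.inr (by exact_mod_cast h0)
    have hbias : ∑ i, kernelWeight K h xs x i * ‖xs i - x‖ ^ H
        ≤ (R₂ * h) ^ H + √k ^ H * √((1 + (N : ℝ))⁻¹) := by
      by_cases hS0 : ∑ j, K (h⁻¹ • (x - xs j)) = 0
      · have hN0 : N = 0 := by
          rcases hN1 with h0 | h0
          · exact h0
          · nlinarith
        rw [hN0]
        refine (sum_mul_rpow_le hH.le (hw0 xs x) (hw1 xs x) fun i _ =>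
          norm_sub_le_of_mem_unitCube (hxs i) hx).trans ?_
        have : 0 ≤ (R₂ * h) ^ H := by positivity
        simpa using this
      · refine (sum_mul_rpow_le hH.le (c := R₂ * h) (hw0 xs x) (hw1 xs x) fun i hi => ?_).trans
          (le_add_of_nonneg_right (by positivity))
        by_contra hlt
        refine hi ?_
        have hnm : h⁻¹ • (x - xs i) ∉ {x : Cov k | ‖x‖ ≤ R₂} := by
          change ¬ ‖h⁻¹ • (x - xs i)‖ ≤ R₂
          rwa [hnorm, inv_mul_le_iff₀ hh, mul_comm]
        have h2 := (hbox (h⁻¹ • (x - xs i))).2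
        rw [Set.indicator_of_notMem hnm] at h2
        rw [kernelWeight, if_neg hS0, le_antisymm h2 (hK0 _), zero_div]
    -- The factor 2 trades `1 / N` for `1 / (1 + N)` when `N ≥ 1`. For `N = 0` the trivial bound 1
    -- suffices because `M₁ ≤ M₂`.
    have hvar : ∑ i, kernelWeight K h xs x i ^ 2 ≤ 2 * M₂ / M₁ * (1 + (N : ℝ))⁻¹ := by
      rw [← div_eq_mul_inv]
      rcases hN1 with h0 | h0
      · refine (sum_sq_le_of_le (hw0 xs x) (hw1 xs x) (c := 1) fun i => ?_).trans ?_
        · rw [← hw1 xs x]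
          exact Finset.single_le_sum (fun j _ => hw0 xs x j) (Finset.mem_univ i)
        · rw [h0, Nat.cast_zero, add_zero, div_one, le_div_iff₀ hM₁]
          linarith
      · refine sum_sq_le_of_le (hw0 xs x) (hw1 xs x) fun i => ?_
        have hSpos : 0 < ∑ j, K (h⁻¹ • (x - xs j)) := lt_of_lt_of_le (by positivity) hS
        rw [kernelWeight, if_neg hSpos.ne']
        calc K (h⁻¹ • (x - xs i)) / ∑ j, K (h⁻¹ • (x - xs j)) ≤ M₂ / (N * M₁) := by
              gcongr
              exact hKle _
          _ ≤ 2 * M₂ / M₁ / (1 + N) := by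
              rw [div_div, div_le_div_iff₀ (by positivity) (by positivity)]
              have : 0 ≤ M₂ * M₁ * (N - 1) :=
                mul_nonneg (by positivity) (by linarith)
              nlinarith
    have hsq := Real.sqrt_le_sqrt hvar
    rw [Real.sqrt_mul (by positivity)] at hsq
    calc _ ≤ L * ((R₂ * h) ^ H + √k ^ H * √((1 + (N : ℝ))⁻¹))
          + √(2 * M₂ / M₁) * √((1 + (N : ℝ))⁻¹) * M := by gcongr
      _ = _ := by rw [hD]; ring
  have := P.2
  refine (risk_weightRule_le (w := kernelWeight K h)
    (B := fun q => ENNReal.ofReal (L * (R₂ * h) ^ H + D * (s / 2) + ∑ j ∈ (Finset.univ : Finset Unit),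
      D / (2 * s) * (1 + (nearCount (√k / m) q.1 q.2 : ℝ))⁻¹)) hL.le hM.le hP hw0 hw1 ?_
    fun xs x hxs hx => ENNReal.ofReal_le_ofReal ((main xs x hxs hx).trans ?_)).trans
    ((lintegral_sum_inv_nearCount_le (Finset.univ : Finset Unit) (m := fun _ => m) (fun _ => hm)
      (a := L * (R₂ * h) ^ H + D * (s / 2)) (by positivity) (b := fun _ => D / (2 * s))
      (fun _ => by positivity) _ (ae_fst_mem_unitCube hP)).trans
      (ENNReal.ofReal_le_ofReal (le_of_eq ?_)))
  · have hc : Measurable fun q : (Fin n → Cov k) × Cov k => (nearCount (√k / m) q.1 q.2 : ℝ) :=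
      (Measurable.of_discrete (f := fun j : ℕ => (j : ℝ))).comp (measurable_nearCount _)
    fun_prop
  · have ht : √((1 + (nearCount (√k / m) xs x : ℝ))⁻¹)
        ≤ s / 2 + 1 / (2 * s) * (1 + (nearCount (√k / m) xs x : ℝ))⁻¹ := by
      set t := √((1 + (nearCount (√k / m) xs x : ℝ))⁻¹) with ht
      have ht2 : (1 + (nearCount (√k / m) xs x : ℝ))⁻¹ = t ^ 2 :=
        (Real.sq_sqrt (by positivity)).symm
      rw [ht2]
      have : s / 2 + 1 / (2 * s) * t ^ 2 - t = (s - t) ^ 2 / (2 * s) := by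
        field_simp
        ring
      have h3 : 0 ≤ (s - t) ^ 2 / (2 * s) := by positivity
      linarith
    simp only [Finset.univ_unique, Finset.sum_singleton]
    calc _ ≤ L * (R₂ * h) ^ H + D * (s / 2 + 1 / (2 * s) *
          (1 + (nearCount (√k / m) xs x : ℝ))⁻¹) := by gcongr
      _ = _ := by ring
  · simp only [Finset.univ_unique, Finset.sum_singleton]
    rw [← hs2]
    field_simp
    ring

/-! ### Risk bounds for the nearest neighbour method -/

/-- If a selected point were farther than `ε`, every point within `ε` would be selected as well,
giving at most `κ - 1` such points. -/
lemma selected_dist_le {k n κ : ℕ} {xs : Fin n → Cov k} {x : Cov k} {A : Finset (Fin n)}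
    (hA : A.card = κ) (hnn : ∀ i ∈ A, ∀ j ∉ A, ‖xs i - x‖ ≤ ‖xs j - x‖) {ε : ℝ}
    (hε : κ ≤ nearCount ε xs x) : ∀ i ∈ A, ‖xs i - x‖ ≤ ε := by
  intro i hi
  by_contra hlt
  have hsub : (Finset.univ.filter fun j => ‖xs j - x‖ ≤ ε) ⊆ A.erase i := by
    intro j hj
    have hj' := (Finset.mem_filter.1 hj).2
    refine Finset.mem_erase.2 ⟨fun h => hlt (h ▸ hj'), ?_⟩
    by_contra hjA
    exact hlt ((hnn i hi j hjA).trans hj')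
  have h1 := Finset.card_le_card hsub
  have h2 := Finset.card_erase_lt_of_mem hi
  simp only [nearCount] at hε
  omega

/-- The ratio `2 ^ a` is at least 2, so the geometric sum is dominated by its next term. It is
applied with `a = k - H`, and `a ≥ 1` is the reason for requiring `k ≥ 2`. -/
lemma sum_two_pow_le {a : ℝ} (ha : 1 ≤ a) (J : ℕ) :
    ∑ j ∈ Finset.range J, ((2 : ℝ) ^ j) ^ a ≤ ((2 : ℝ) ^ J) ^ a := by
  induction J with
  | zero => simp
  | succ J ih =>
    rw [Finset.sum_range_succ, pow_succ, Real.mul_rpow (by positivity) (by norm_num)]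
    have h2 : (2 : ℝ) ≤ 2 ^ a := by
      simpa using Real.rpow_le_rpow_of_exponent_le (x := 2) (by norm_num) ha
    have : 0 ≤ ((2 : ℝ) ^ J) ^ a := by positivity
    nlinarith

/-- Induction on the dyadic resolution. Either at least `κ` points lie within the next finer scale,
and then so do all selected ones, or `κ / (1 + N) ≥ 1` at that scale and the new summand pays for
the old leading term. -/
lemma nnWeight_bias_le {k n κ : ℕ} (hκ : 1 ≤ κ) {H : ℝ} (hH : 0 < H) {xs : Fin n → Cov k}
    {x : Cov k} (hxs : ∀ i, xs i ∈ unitCube k) (hx : x ∈ unitCube k) {A : Finset (Fin n)}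
    (hA : A.card = κ) (hnn : ∀ i ∈ A, ∀ j ∉ A, ‖xs i - x‖ ≤ ‖xs j - x‖) {w : Fin n → ℝ}
    (hw : ∀ i, 0 ≤ w i) (hw1 : ∑ i, w i = 1) (hwA : ∀ i, w i ≠ 0 → i ∈ A) (J : ℕ) :
    ∑ i, w i * ‖xs i - x‖ ^ H ≤ (√k / (2 : ℝ) ^ J) ^ H + ∑ j ∈ Finset.range J,
      (√k / (2 : ℝ) ^ j) ^ H * κ *
        (1 + (nearCount (√k / (2 ^ (j + 1) : ℕ)) xs x : ℝ))⁻¹ := by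
  have hT : ∀ j : ℕ, 0 ≤ (√k / (2 : ℝ) ^ j) ^ H * κ *
      (1 + (nearCount (√k / (2 ^ (j + 1) : ℕ)) xs x : ℝ))⁻¹ := fun j => by positivity
  induction J with
  | zero =>
    simpa using sum_mul_rpow_le hH.le hw hw1 fun i _ => norm_sub_le_of_mem_unitCube (hxs i) hx
  | succ J ih =>
    rw [Finset.sum_range_succ]
    by_cases hc : κ ≤ nearCount (√k / (2 ^ (J + 1) : ℕ)) xs x
    · have h1 := selected_dist_le hA hnn hc
      have h2 := sum_mul_rpow_le hH.le hw hw1 fun i hi => h1 i (hwA i hi)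
      push_cast at h2
      exact h2.trans (le_add_of_nonneg_right
        (add_nonneg (Finset.sum_nonneg fun j _ => hT j) (hT J)))
    · have h1 : (1 : ℝ) ≤ κ * (1 + (nearCount (√k / (2 ^ (J + 1) : ℕ)) xs x : ℝ))⁻¹ := by
        rw [← div_eq_mul_inv, le_div_iff₀ (by positivity), one_mul]
        have : 1 + nearCount (√k / (2 ^ (J + 1) : ℕ)) xs x ≤ κ := by omega
        exact_mod_cast this
      have h2 : (√k / (2 : ℝ) ^ J) ^ H ≤ (√k / (2 : ℝ) ^ J) ^ H * κ *
          (1 + (nearCount (√k / (2 ^ (J + 1) : ℕ)) xs x : ℝ))⁻¹ := by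
        rw [mul_assoc]
        exact le_mul_of_one_le_right (by positivity) h1
      have h3 : 0 ≤ (√k / (2 : ℝ) ^ (J + 1)) ^ H := by positivity
      linarith

lemma sum_nnWeight {n κ : ℕ} (hκ : 1 ≤ κ) {A : Finset (Fin n)} (hA : A.card = κ) :
    ∑ i, (if i ∈ A then 1 / (κ : ℝ) else 0) = 1 := by
  have : (κ : ℝ) ≠ 0 := by positivity
  simp [hA, this]

lemma risk_nnRule_le {k n κ : ℕ} (hk : 2 ≤ k) (hκ : 1 ≤ κ) {H L M : ℝ} (hH : 0 < H)
    (hH1 : H ≤ 1) (hL : 0 < L) (hM : 0 < M) {T : Type} [MeasurableSpace T]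
    {S : T × (Fin n → Cov k) × Cov k → Finset (Fin n)} (hS : IsNNSelection κ S) (t : T) (J : ℕ)
    {P : ProbabilityMeasure (Cov k × ℝ)} (hP : P ∈ classD k H L M) :
    risk P (nnRule κ S t) ≤ ENNReal.ofReal (√(1 / κ) * M + L * √k ^ H * ((2 : ℝ) ^ J) ^ (-H) *
      (1 + 4 ^ k * (κ / (n + 1)) * ((2 : ℝ) ^ J) ^ k)) := by
  set w : (Fin n → Cov k) → Cov k → Fin n → ℝ :=
    fun xs x i => if i ∈ S (t, xs, x) then 1 / (κ : ℝ) else 0 with hw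
  have hw0 : ∀ xs x i, 0 ≤ w xs x i := fun xs x i => by
    simp only [hw]; split_ifs <;> positivity
  have hw1 : ∀ xs x, ∑ i, w xs x i = 1 := fun xs x => sum_nnWeight hκ (hS.2 (t, xs, x)).1
  have := P.2
  refine (risk_weightRule_le (w := w)
    (B := fun q => ENNReal.ofReal (√(1 / κ) * M + L * (√k / (2 : ℝ) ^ J) ^ H
      + ∑ j ∈ Finset.range J, L * ((√k / (2 : ℝ) ^ j) ^ H * κ) *
        (1 + (nearCount (√k / (2 ^ (j + 1) : ℕ)) q.1 q.2 : ℝ))⁻¹)) hL.le hM.le hP hw0 hw1 ?_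
    fun xs x hxs hx => ENNReal.ofReal_le_ofReal ?_).trans
    ((lintegral_sum_inv_nearCount_le (Finset.range J) (m := fun j => 2 ^ (j + 1))
      (fun _ => Nat.one_le_two_pow)
      (a := √(1 / κ) * M + L * (√k / (2 : ℝ) ^ J) ^ H) (by positivity)
      (b := fun j => L * ((√k / (2 : ℝ) ^ j) ^ H * κ))
      (fun _ => by positivity) _ (ae_fst_mem_unitCube hP)).trans
      (ENNReal.ofReal_le_ofReal ?_))
  · have hc : ∀ j, Measurable fun q : (Fin n → Cov k) × Cov k =>
        (nearCount (√k / (2 ^ (j + 1) : ℕ)) q.1 q.2 : ℝ) := fun j =>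
      (Measurable.of_discrete (f := fun j : ℕ => (j : ℝ))).comp (measurable_nearCount _)
    fun_prop
  · have hvar : ∑ i, w xs x i ^ 2 ≤ 1 / κ :=
      sum_sq_le_of_le (hw0 xs x) (hw1 xs x) fun i => by
        simp only [hw]; split_ifs
        · exact le_rfl
        · positivity
    have hbias := nnWeight_bias_le hκ hH hxs hx (hS.2 (t, xs, x)).1 (hS.2 (t, xs, x)).2
      (hw0 xs x) (hw1 xs x) (fun i hi => by
        by_contra hni
        exact hi (by simp only [hw]; exact if_neg hni)) J
    calc _ ≤ L * ((√k / (2 : ℝ) ^ J) ^ H + ∑ j ∈ Finset.range J, (√k / (2 : ℝ) ^ j) ^ H * κ *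
        (1 + (nearCount (√k / (2 ^ (j + 1) : ℕ)) xs x : ℝ))⁻¹) + √(1 / κ) * M := by gcongr
      _ = _ := by
        rw [mul_add, Finset.mul_sum]
        simp_rw [mul_assoc]
        ring
  · have hdiv : ∀ j : ℕ, (√k / (2 : ℝ) ^ j) ^ H = √k ^ H * ((2 : ℝ) ^ j) ^ (-H) := fun j => by
      rw [Real.div_rpow (by positivity) (by positivity), Real.rpow_neg (by positivity),
        div_eq_mul_inv]
    have hpow : ∀ j : ℕ, ((2 : ℝ) ^ j) ^ (-H) * ((2 : ℝ) ^ j) ^ k = ((2 : ℝ) ^ j) ^ ((k : ℝ) - H) :=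
      fun j => by
        rw [← Real.rpow_natCast ((2 : ℝ) ^ j) k, ← Real.rpow_add (by positivity)]
        ring_nf
    have hsum : ∑ j ∈ Finset.range J, L * ((√k / (2 : ℝ) ^ j) ^ H * κ) *
          ((((2 ^ (j + 1) : ℕ) : ℝ) + 1) ^ k / (n + 1))
        ≤ L * √k ^ H * 4 ^ k * (κ / (n + 1)) * (((2 : ℝ) ^ J) ^ (-H) * ((2 : ℝ) ^ J) ^ k) := by
      calc _ ≤ ∑ j ∈ Finset.range J, L * √k ^ H * 4 ^ k * (κ / (n + 1)) *
            ((2 : ℝ) ^ j) ^ ((k : ℝ) - H) := by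
            refine Finset.sum_le_sum fun j _ => ?_
            -- The source of the constant `4 ^ k`.
            have h4 : ((2 ^ (j + 1) : ℕ) : ℝ) + 1 ≤ 4 * 2 ^ j := by
              have : (1 : ℝ) ≤ 2 ^ j := one_le_pow₀ (by norm_num)
              push_cast
              rw [pow_succ]
              linarith
            calc _ ≤ L * ((√k / (2 : ℝ) ^ j) ^ H * κ) * ((4 * 2 ^ j) ^ k / (n + 1)) := by gcongr
              _ = _ := by
                rw [hdiv, ← hpow, mul_pow]
                ring
        _ = L * √k ^ H * 4 ^ k * (κ / (n + 1)) *
            ∑ j ∈ Finset.range J, ((2 : ℝ) ^ j) ^ ((k : ℝ) - H) := by rw [Finset.mul_sum]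
        _ ≤ _ := by
            rw [hpow]
            have hk' : (2 : ℝ) ≤ k := by exact_mod_cast hk
            gcongr
            exact sum_two_pow_le (by linarith) J
    rw [hdiv J]
    refine (add_le_add le_rfl hsum).trans (le_of_eq ?_)
    ring

/-! ### Measurability of rules and of the distance -/

lemma measurable_weightedEmpirical {α : Type*} [MeasurableSpace α] {n : ℕ} {w y : α → Fin n → ℝ}
    (hw : ∀ i, Measurable fun a => w a i) (hy : ∀ i, Measurable fun a => y a i) :
    Measurable fun a => weightedEmpirical (w a) (y a) := by
  refine Measure.measurable_of_measurable_coe _ fun s hs => ?_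
  simp only [weightedEmpirical, Measure.finsetSum_apply, Measure.smul_apply, smul_eq_mul]
  refine Finset.measurable_sum _ fun i _ => (hw i).ennreal_ofReal.mul ?_
  exact (Measure.measurable_coe hs).comp (Measure.measurable_dirac.comp (hy i))

lemma measurable_real_Iic_prod {α : Type*} [MeasurableSpace α] {κ : α → Measure ℝ}
    (hκ : Measurable κ) (hκ1 : ∀ a, IsProbabilityMeasure (κ a)) :
    Measurable fun p : α × ℝ => (κ p.1).real (Set.Iic p.2) := by
  let K : Kernel (α × ℝ) ℝ := ⟨fun p => κ p.1, hκ.comp measurable_fst⟩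
  have : IsMarkovKernel K := ⟨fun p => hκ1 p.1⟩
  have ht : MeasurableSet {p : (α × ℝ) × ℝ | p.2 ≤ p.1.2} :=
    measurableSet_le measurable_snd (measurable_snd.comp measurable_fst)
  exact (Kernel.measurable_kernel_prodMk_left (κ := K) ht).ennreal_toReal

/-- The lower bound needs exact iterated integrals, hence a measurable integrand; `cdfDist` provides
one and lies below `W1`. -/
lemma measurable_cdfDist {α : Type*} [MeasurableSpace α] {κ η : α → Measure ℝ}
    (hκ : Measurable κ) (hη : Measurable η) (hκ1 : ∀ a, IsProbabilityMeasure (κ a))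
    (hη1 : ∀ a, IsProbabilityMeasure (η a)) : Measurable fun a => cdfDist (κ a) (η a) :=
  ((measurable_real_Iic_prod hκ hκ1).edist (measurable_real_Iic_prod hη hη1)).lintegral_prod_right'

/-! ### Two-point distributions -/

/-- The distribution on `{0, b}` that gives mass `p` to `b`. -/
noncomputable def twoPoint (b p : ℝ) : Measure ℝ := weightedEmpirical ![1 - p, p] ![0, b]

lemma twoPoint_weights_nonneg {p : ℝ} (h0 : 0 ≤ p) (h1 : p ≤ 1) (i : Fin 2) :
    0 ≤ (![1 - p, p] : Fin 2 → ℝ) i := by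
  fin_cases i
  · simpa using h1
  · simpa using h0

lemma isProbabilityMeasure_twoPoint (b : ℝ) {p : ℝ} (h0 : 0 ≤ p) (h1 : p ≤ 1) :
    IsProbabilityMeasure (twoPoint b p) :=
  isProbabilityMeasure_weightedEmpirical (twoPoint_weights_nonneg h0 h1) (by simp) _

lemma twoPoint_real_Iic (b : ℝ) {p : ℝ} (h0 : 0 ≤ p) (h1 : p ≤ 1) (z : ℝ) :
    (twoPoint b p).real (Set.Iic z) = (1 - p) * (Set.Ici 0).indicator (1 : ℝ → ℝ) z
      + p * (Set.Ici b).indicator (1 : ℝ → ℝ) z := by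
  rw [twoPoint, weightedEmpirical_real_Iic (twoPoint_weights_nonneg h0 h1)]
  simp [Fin.sum_univ_two]

lemma cdfDist_twoPoint {b p p' : ℝ} (hb : 0 ≤ b) (h0 : 0 ≤ p) (h1 : p ≤ 1) (h0' : 0 ≤ p')
    (h1' : p' ≤ 1) : cdfDist (twoPoint b p) (twoPoint b p') = ENNReal.ofReal (b * |p - p'|) := by
  have hz : ∀ z, edist ((twoPoint b p).real (Set.Iic z)) ((twoPoint b p').real (Set.Iic z))
      = ENNReal.ofReal |p - p'| * edist ((Set.Ici 0).indicator (1 : ℝ → ℝ) z)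
        ((Set.Ici b).indicator 1 z) := by
    intro z
    rw [twoPoint_real_Iic b h0 h1, twoPoint_real_Iic b h0' h1', edist_dist, edist_dist,
      Real.dist_eq, Real.dist_eq, ← ENNReal.ofReal_mul (abs_nonneg _), ← abs_mul, ← abs_neg]
    congr 2
    ring
  unfold cdfDist
  simp_rw [hz]
  rw [lintegral_const_mul' _ _ ENNReal.ofReal_ne_top, lintegral_edist_indicator_Ici, edist_dist,
    Real.dist_eq, zero_sub, abs_neg, abs_of_nonneg hb, mul_comm, ← ENNReal.ofReal_mul hb]

lemma lintegral_sqrt_cdf_twoPoint_le {b p : ℝ} (hb : 0 ≤ b) (h0 : 0 ≤ p) (h1 : p ≤ 1) :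
    ∫⁻ z, ENNReal.ofReal (√(cdf (twoPoint b p) z * (1 - cdf (twoPoint b p) z)))
      ≤ ENNReal.ofReal b := by
  have := isProbabilityMeasure_twoPoint b h0 h1
  have hE : edist (0 : ℝ) b = ENNReal.ofReal b := by
    rw [edist_dist, Real.dist_eq, zero_sub, abs_neg, abs_of_nonneg hb]
  rw [← hE, ← lintegral_edist_indicator_Ici]
  refine lintegral_mono fun z => ?_
  simp only [cdf_eq_real, twoPoint_real_Iic b h0 h1, edist_dist, Real.dist_eq]
  refine ENNReal.ofReal_le_ofReal ?_
  by_cases h2 : (0 : ℝ) ≤ z <;> by_cases h3 : b ≤ z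
  · simp [Set.indicator, h2, h3]
  · simp only [Set.indicator, Set.mem_Ici, h2, h3, if_true, if_false, Pi.one_apply]
    rw [Real.sqrt_le_iff]
    constructor
    · positivity
    · norm_num
      nlinarith
  · exact absurd (hb.trans h3) h2
  · simp [Set.indicator, h2, h3]

lemma measurable_twoPoint (b : ℝ) {α : Type*} [MeasurableSpace α] {p : α → ℝ} (hp : Measurable p) :
    Measurable fun a => twoPoint b (p a) := by
  refine measurable_weightedEmpirical (fun i => ?_) fun i => measurable_const
  fin_cases i
  · exact hp.const_sub 1
  · simpa using hp

/-! ### The perturbed regression functions -/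

/-- The points of a regular grid in the unit cube. -/
noncomputable def gridPoint {k m : ℕ} (g : Fin k → Fin m) : Cov k :=
  WithLp.toLp 2 fun j => (g j : ℝ) / m

lemma gridPoint_mem {k m : ℕ} (g : Fin k → Fin m) : gridPoint g ∈ unitCube k := by
  intro j
  have h : ((g j : ℕ) : ℝ) ≤ m := by exact_mod_cast (g j).2.le
  exact ⟨by simp only [gridPoint]; positivity, div_le_one_of_le₀ h (Nat.cast_nonneg m)⟩

lemma one_div_le_norm_gridPoint_sub {k m : ℕ} (hm : 1 ≤ m) {g g' : Fin k → Fin m} (h : g ≠ g') :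
    1 / (m : ℝ) ≤ ‖gridPoint g - gridPoint g'‖ := by
  obtain ⟨j, hj⟩ := Function.ne_iff.1 h
  have hm0 : (0 : ℝ) < m := by exact_mod_cast hm
  refine le_trans ?_ (PiLp.norm_apply_le (gridPoint g - gridPoint g') j)
  have hne : ((g j : ℕ) : ℤ) - (g' j : ℕ) ≠ 0 := fun h0 => hj (Fin.ext (by omega))
  have h1 : (1 : ℝ) ≤ |((g j : ℕ) : ℝ) - (g' j : ℕ)| := by exact_mod_cast Int.one_le_abs hne
  have h2 : (gridPoint g - gridPoint g') j = (((g j : ℕ) : ℝ) - (g' j : ℕ)) / m := by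
    simp only [gridPoint, PiLp.sub_apply]
    ring
  rw [h2, Real.norm_eq_abs, abs_div, abs_of_pos hm0]
  gcongr

/-- The sign attached to a truth value. -/
def boolSign (b : Bool) : ℝ := if b then 1 else -1

lemma boolSign_not (b : Bool) : boolSign (!b) = -boolSign b := by
  cases b <;> simp [boolSign]

lemma neg_one_le_boolSign (b : Bool) : -1 ≤ boolSign b := by cases b <;> simp [boolSign]

lemma boolSign_le_one (b : Bool) : boolSign b ≤ 1 := by cases b <;> simp [boolSign]

/-- The lower envelope of the functions `± δ + c ‖x - g‖ ^ H`, one for each grid point. -/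
noncomputable def envelope {k m : ℕ} [NeZero m] (δ c H : ℝ) (σ : (Fin k → Fin m) → Bool)
    (x : Cov k) : ℝ :=
  min δ (Finset.univ.inf' Finset.univ_nonempty
    fun g => boolSign (σ g) * δ + c * ‖x - gridPoint g‖ ^ H)

section envelope

variable {k m : ℕ} [NeZero m] {δ c H : ℝ} (σ : (Fin k → Fin m) → Bool)

lemma envelope_le (x : Cov k) : envelope δ c H σ x ≤ δ := min_le_left _ _

lemma neg_le_envelope (hδ : 0 ≤ δ) (hc : 0 ≤ c) (x : Cov k) : -δ ≤ envelope δ c H σ x := by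
  refine le_min (by linarith) (Finset.le_inf' _ _ fun g _ => ?_)
  have h1 := neg_one_le_boolSign (σ g)
  have h2 : 0 ≤ c * ‖x - gridPoint g‖ ^ H := by positivity
  nlinarith

lemma continuous_envelope (hH : 0 < H) : Continuous (envelope δ c H σ) := by
  refine continuous_const.min (Continuous.finset_inf'_apply _ fun g _ => ?_)
  refine continuous_const.add (continuous_const.mul ?_)
  exact (continuous_id.sub continuous_const).norm.rpow_const fun _ => Or.inr hH.le

/-- For `H ≤ 1` the function `t ^ H` is subadditive, so each cone is Hölder with constant `c`, and
minima preserve this. -/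
lemma envelope_le_add (hc : 0 ≤ c) (hH : 0 < H) (hH1 : H ≤ 1) (x y : Cov k) :
    envelope δ c H σ x ≤ envelope δ c H σ y + c * ‖x - y‖ ^ H := by
  have h0 : 0 ≤ c * ‖x - y‖ ^ H := by positivity
  rw [← sub_le_iff_le_add]
  refine le_min (by linarith [envelope_le (δ := δ) (c := c) (H := H) σ x])
    (Finset.le_inf' _ _ fun g _ => ?_)
  have h1 : envelope δ c H σ x ≤ boolSign (σ g) * δ + c * ‖x - gridPoint g‖ ^ H :=
    (min_le_right _ _).trans (Finset.inf'_le _ (Finset.mem_univ g))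
  have h2 : ‖x - gridPoint g‖ ^ H ≤ ‖x - y‖ ^ H + ‖y - gridPoint g‖ ^ H :=
    (Real.rpow_le_rpow (norm_nonneg _) (norm_sub_le_norm_sub_add_norm_sub _ y _) hH.le).trans
      (Real.rpow_add_le_add_rpow (norm_nonneg _) (norm_nonneg _) hH.le hH1)
  have h3 := mul_le_mul_of_nonneg_left h2 hc
  linarith

lemma abs_envelope_sub_le (hc : 0 ≤ c) (hH : 0 < H) (hH1 : H ≤ 1) (x y : Cov k) :
    |envelope δ c H σ x - envelope δ c H σ y| ≤ c * ‖x - y‖ ^ H := by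
  have h1 := envelope_le_add (δ := δ) σ hc hH hH1 x y
  have h2 := envelope_le_add (δ := δ) σ hc hH hH1 y x
  rw [norm_sub_rev y x] at h2
  exact abs_le.2 ⟨by linarith, by linarith⟩

/-- Grid points are `1 / m` apart, so at `g` the cone of any other grid point has already risen from
at least `-δ` to at least `δ` and does not undercut the prescribed value. -/
lemma envelope_gridPoint (hδ : 0 ≤ δ) (hc : 0 ≤ c) (hH : 0 < H)
    (hδc : 2 * δ ≤ c * (1 / (m : ℝ)) ^ H) (g : Fin k → Fin m) :
    envelope δ c H σ (gridPoint g) = boolSign (σ g) * δ := by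
  have hle : boolSign (σ g) * δ ≤ δ := by
    have := boolSign_le_one (σ g)
    nlinarith
  refine le_antisymm ?_ (le_min hle (Finset.le_inf' _ _ fun g' _ => ?_))
  · refine (min_le_right _ _).trans ((Finset.inf'_le _ (Finset.mem_univ g)).trans ?_)
    simp [Real.zero_rpow hH.ne']
  · by_cases h : g = g'
    · subst h
      have : 0 ≤ c * ‖gridPoint g - gridPoint g‖ ^ H := by positivity
      linarith
    · have h1 := Real.rpow_le_rpow (by positivity)
        (one_div_le_norm_gridPoint_sub (NeZero.one_le (n := m)) h) hH.le
      have h2 := mul_le_mul_of_nonneg_left h1 hc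
      have h3 := neg_one_le_boolSign (σ g')
      nlinarith

end envelope

/-! ### The finite sub-model -/

/-- The probabilities of the cells of the finite sub-model. -/
noncomputable def cellProb {k m : ℕ} (δ : ℝ) (σ : (Fin k → Fin m) → Bool)
    (a : (Fin k → Fin m) × Bool) : ℝ :=
  1 / (m : ℝ) ^ k * (1 / 2 + boolSign (σ a.1) * boolSign a.2 * δ)

/-- The observation that belongs to a cell of the finite sub-model. -/
noncomputable def cellPoint {k m : ℕ} (b : ℝ) (a : (Fin k → Fin m) × Bool) : Cov k × ℝ :=
  (gridPoint a.1, if a.2 then b else 0)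

/-- The uniform distribution on the grid. -/
noncomputable def gridMeasure (k m : ℕ) : Measure (Cov k) :=
  ∑ g : Fin k → Fin m, ENNReal.ofReal (1 / (m : ℝ) ^ k) • Measure.dirac (gridPoint g)

lemma isProbabilityMeasure_gridMeasure (k m : ℕ) [NeZero m] :
    IsProbabilityMeasure (gridMeasure k m) := by
  refine ⟨?_⟩
  have hm : (0 : ℝ) < (m : ℝ) ^ k := by
    have : (0 : ℝ) < m := by exact_mod_cast NeZero.pos m
    positivity
  simp only [gridMeasure, Measure.finsetSum_apply, Measure.smul_apply, measure_univ, smul_eq_mul,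
    mul_one]
  rw [← ENNReal.ofReal_sum_of_nonneg fun _ _ => by positivity]
  simp [hm.ne']

lemma lintegral_gridMeasure (k m : ℕ) (f : Cov k → ℝ≥0∞) :
    ∫⁻ x, f x ∂(gridMeasure k m)
      = ∑ g : Fin k → Fin m, ENNReal.ofReal (1 / (m : ℝ) ^ k) * f (gridPoint g) := by
  simp [gridMeasure, lintegral_smul_measure, lintegral_dirac]

/-- The distribution of the cells in the finite sub-model. -/
noncomputable def cellMeasure {k m : ℕ} (δ : ℝ) (σ : (Fin k → Fin m) → Bool) :
    Measure ((Fin k → Fin m) × Bool) :=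
  ∑ a, ENNReal.ofReal (cellProb δ σ a) • Measure.dirac a

lemma cellMeasure_singleton {k m : ℕ} (δ : ℝ) (σ : (Fin k → Fin m) → Bool)
    (a : (Fin k → Fin m) × Bool) :
    cellMeasure δ σ {a} = ENNReal.ofReal (cellProb δ σ a) := by
  classical
  simp only [cellMeasure, Measure.finsetSum_apply, Measure.smul_apply, smul_eq_mul,
    Measure.dirac_apply' _ (measurableSet_singleton a)]
  simp [Set.indicator]

lemma cellProb_nonneg {k m : ℕ} {δ : ℝ} (σ : (Fin k → Fin m) → Bool) (hδ : 0 ≤ δ) (hδ1 : δ ≤ 1 / 4)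
    (a : (Fin k → Fin m) × Bool) : 0 ≤ cellProb δ σ a := by
  unfold cellProb
  refine mul_nonneg (by positivity) ?_
  rcases a with ⟨g, _ | _⟩ <;> cases σ g <;> simp [boolSign] <;> linarith

section submodel

variable {k m : ℕ} [NeZero m] {δ c H b : ℝ} (σ : (Fin k → Fin m) → Bool)

/-- The conditional distributions of the finite sub-model. -/
noncomputable def perturbedKernel (b δ c H : ℝ) (hH : 0 < H) (σ : (Fin k → Fin m) → Bool) :
    Kernel (Cov k) ℝ :=
  ⟨fun x => twoPoint b (1 / 2 + envelope δ c H σ x),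
    measurable_twoPoint b ((continuous_envelope σ hH).measurable.const_add _)⟩

lemma perturbedKernel_apply (hH : 0 < H) (x : Cov k) :
    perturbedKernel b δ c H hH σ x = twoPoint b (1 / 2 + envelope δ c H σ x) := rfl

lemma half_add_envelope_mem (hδ : 0 ≤ δ) (hδ1 : δ ≤ 1 / 4) (hc : 0 ≤ c) (x : Cov k) :
    0 ≤ 1 / 2 + envelope δ c H σ x ∧ 1 / 2 + envelope δ c H σ x ≤ 1 := by
  have h1 := envelope_le (δ := δ) (c := c) (H := H) σ x
  have h2 := neg_le_envelope (H := H) σ hδ hc x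
  constructor <;> linarith

lemma isMarkovKernel_perturbedKernel (hδ : 0 ≤ δ) (hδ1 : δ ≤ 1 / 4) (hc : 0 ≤ c) (hH : 0 < H) :
    IsMarkovKernel (perturbedKernel b δ c H hH σ) :=
  ⟨fun x => isProbabilityMeasure_twoPoint b (half_add_envelope_mem σ hδ hδ1 hc x).1
    (half_add_envelope_mem σ hδ hδ1 hc x).2⟩

/-- The joint distributions of the finite sub-model. -/
noncomputable def perturbedLaw (b : ℝ) {δ c H : ℝ} (hδ : 0 ≤ δ) (hδ1 : δ ≤ 1 / 4) (hc : 0 ≤ c)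
    (hH : 0 < H) (σ : (Fin k → Fin m) → Bool) : ProbabilityMeasure (Cov k × ℝ) :=
  ⟨(gridMeasure k m).compProd (perturbedKernel b δ c H hH σ), by
    have := isProbabilityMeasure_gridMeasure k m
    have := isMarkovKernel_perturbedKernel (b := b) σ hδ hδ1 hc hH
    infer_instance⟩

lemma coe_perturbedLaw (hδ : 0 ≤ δ) (hδ1 : δ ≤ 1 / 4) (hc : 0 ≤ c) (hH : 0 < H) :
    (perturbedLaw b hδ hδ1 hc hH σ : Measure (Cov k × ℝ))
      = (gridMeasure k m).compProd (perturbedKernel b δ c H hH σ) := rfl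

lemma fst_perturbedLaw (hδ : 0 ≤ δ) (hδ1 : δ ≤ 1 / 4) (hc : 0 ≤ c) (hH : 0 < H) :
    (perturbedLaw b hδ hδ1 hc hH σ : Measure (Cov k × ℝ)).fst = gridMeasure k m := by
  have := isProbabilityMeasure_gridMeasure k m
  have := isMarkovKernel_perturbedKernel (b := b) σ hδ hδ1 hc hH
  rw [coe_perturbedLaw, Measure.fst_compProd]

/-- On the grid the success probability depends only on the sign there, so the law lives on finitely
many cells and the testing argument reduces to finite sums. -/
lemma coe_perturbedLaw_eq_map (hδ : 0 ≤ δ) (hδ1 : δ ≤ 1 / 4) (hc : 0 ≤ c) (hH : 0 < H)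
    (hδc : 2 * δ ≤ c * (1 / (m : ℝ)) ^ H) :
    (perturbedLaw b hδ hδ1 hc hH σ : Measure (Cov k × ℝ))
      = (cellMeasure δ σ).map (cellPoint b) := by
  have := isProbabilityMeasure_gridMeasure k m
  have := isMarkovKernel_perturbedKernel (b := b) σ hδ hδ1 hc hH
  ext s hs
  have hcm : Measurable (cellPoint (k := k) (m := m) b) := .of_discrete
  rw [coe_perturbedLaw, Measure.compProd_apply hs, lintegral_gridMeasure,
    Measure.map_apply hcm hs]
  simp only [cellMeasure, Measure.finsetSum_apply, Measure.smul_apply, smul_eq_mul,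
    Measure.dirac_apply' _ (hcm hs)]
  rw [Fintype.sum_prod_type]
  refine Finset.sum_congr rfl fun g _ => ?_
  rw [perturbedKernel_apply, envelope_gridPoint σ hδ hc hH hδc, twoPoint, weightedEmpirical]
  rw [Measure.finsetSum_apply, Fin.sum_univ_two, Fintype.sum_bool]
  simp only [Measure.smul_apply, smul_eq_mul, Measure.dirac_apply' _ (measurable_prodMk_left hs)]
  have hp : (0 : ℝ) ≤ 1 / (m : ℝ) ^ k := by positivity
  rw [mul_add, ← mul_assoc, ← mul_assoc, ← ENNReal.ofReal_mul hp, ← ENNReal.ofReal_mul hp, add_comm]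
  have h1 : 1 / (m : ℝ) ^ k * (![1 - (1 / 2 + boolSign (σ g) * δ), 1 / 2 + boolSign (σ g) * δ] :
      Fin 2 → ℝ) 1 = cellProb δ σ (g, true) := by
    simp [cellProb, boolSign]
  have h2 : 1 / (m : ℝ) ^ k * (![1 - (1 / 2 + boolSign (σ g) * δ), 1 / 2 + boolSign (σ g) * δ] :
      Fin 2 → ℝ) 0 = cellProb δ σ (g, false) := by
    simp only [cellProb, boolSign, Matrix.cons_val_zero]
    simp only [Bool.false_eq_true, if_false]
    ring
  rw [h1, h2]
  congr 2

/-- Responses in `{0, M}` meet the spread condition because the integrand is at most 1 on an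
interval of length `M`. They also multiply differences of success probabilities by `M`, hence the
Hölder constant `L / M` for the envelope. -/
lemma perturbedLaw_mem_classD {L M : ℝ} (hM : 0 < M) (hδ : 0 ≤ δ) (hδ1 : δ ≤ 1 / 4)
    (hL : 0 ≤ L / M) (hH : 0 < H) (hH1 : H ≤ 1) (hδc : 2 * δ ≤ L / M * (1 / (m : ℝ)) ^ H) :
    perturbedLaw M hδ hδ1 hL hH σ ∈ classD k H L M := by
  have := isProbabilityMeasure_gridMeasure k m
  have hK := isMarkovKernel_perturbedKernel (b := M) σ hδ hδ1 hL hH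
  have hcm : Measurable (cellPoint (k := k) (m := m) M) := .of_discrete
  have hmap := coe_perturbedLaw_eq_map (b := M) σ hδ hδ1 hL hH hδc
  have hmem := half_add_envelope_mem (H := H) σ hδ hδ1 hL
  refine ⟨?_, ?_, perturbedKernel M δ (L / M) H hH σ, hK, ?_, ?_, ?_⟩
  · rw [hmap, ae_map_iff hcm.aemeasurable (measurable_fst (measurableSet_unitCube k))]
    exact ae_of_all _ fun a => gridPoint_mem a.1
  · refine Integrable.of_bound measurable_snd.aestronglyMeasurable M ?_
    rw [hmap, ae_map_iff hcm.aemeasurable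
      (measurableSet_le measurable_snd.norm measurable_const)]
    refine ae_of_all _ fun a => ?_
    rcases a with ⟨g, _ | _⟩
    · simpa [cellPoint] using hM.le
    · simp [cellPoint, abs_of_pos hM]
  · rw [fst_perturbedLaw, coe_perturbedLaw]
  · intro x _ x' _
    refine (W1_le_cdfDist _ _).trans ?_
    rw [perturbedKernel_apply, perturbedKernel_apply, cdfDist_twoPoint hM.le (hmem x).1 (hmem x).2
      (hmem x').1 (hmem x').2]
    refine ENNReal.ofReal_le_ofReal ?_
    rw [add_sub_add_left_eq_sub]
    calc M * |envelope δ (L / M) H σ x - envelope δ (L / M) H σ x'|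
        ≤ M * (L / M * ‖x - x'‖ ^ H) := by
          gcongr
          exact abs_envelope_sub_le σ hL hH hH1 x x'
      _ = L * ‖x - x'‖ ^ H := by field_simp
  · exact fun x _ => lintegral_sqrt_cdf_twoPoint_le hM.le (hmem x).1 (hmem x).2

/-- The risk in the finite sub-model, bounded below by a finite sum. -/
lemma le_risk_perturbedLaw (hδ : 0 ≤ δ) (hδ1 : δ ≤ 1 / 4) (hc : 0 ≤ c) (hH : 0 < H)
    (hδc : 2 * δ ≤ c * (1 / (m : ℝ)) ^ H) {n : ℕ} {G : Rule k n} (hG : IsEstimator G) :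
    ∑ g : Fin k → Fin m, ENNReal.ofReal (1 / (m : ℝ) ^ k) *
      ∑ ω : Fin n → (Fin k → Fin m) × Bool, ENNReal.ofReal (∏ i, cellProb δ σ (ω i)) *
        cdfDist (G (fun i => cellPoint b (ω i), gridPoint g))
          (twoPoint b (1 / 2 + boolSign (σ g) * δ))
      ≤ risk (perturbedLaw b hδ hδ1 hc hH σ) G := by
  have := isProbabilityMeasure_gridMeasure k m
  have hK := isMarkovKernel_perturbedKernel (b := b) σ hδ hδ1 hc hH
  have hcm : Measurable (cellPoint (k := k) (m := m) b) := .of_discrete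
  have hG1 := hG.2
  set P := perturbedLaw b hδ hδ1 hc hH σ with hP
  set F := perturbedKernel b δ c H hH σ with hF
  have hfst : (P : Measure (Cov k × ℝ)).fst = gridMeasure k m := fst_perturbedLaw σ hδ hδ1 hc hH
  have hmap : (P : Measure (Cov k × ℝ)) = (cellMeasure δ σ).map (cellPoint b) :=
    coe_perturbedLaw_eq_map σ hδ hδ1 hc hH hδc
  have hcond : ∀ᵐ x ∂(P : Measure (Cov k × ℝ)).fst,
      F x = (P : Measure (Cov k × ℝ)).condKernel x :=
    eq_condKernel_of_measure_eq_compProd F (by rw [hfst]; rfl)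
  have hfm : Measurable fun q : (Fin n → Cov k × ℝ) × Cov k => cdfDist (G q) (F q.2) :=
    measurable_cdfDist hG.1 (F.measurable.comp measurable_snd) hG1 fun q => hK.1 q.2
  have hcond2 : ∀ᵐ q ∂((Measure.pi fun _ : Fin n => (P : Measure (Cov k × ℝ))).prod
      (P : Measure (Cov k × ℝ)).fst), F q.2 = (P : Measure (Cov k × ℝ)).condKernel q.2 :=
    Measure.quasiMeasurePreserving_snd.ae hcond
  have hfin : IsFiniteMeasure (cellMeasure δ σ) := by
    refine ⟨?_⟩
    rw [cellMeasure, Measure.finsetSum_apply]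
    refine ENNReal.sum_lt_top.2 fun a _ => ?_
    simp
  calc _ = ∫⁻ q, cdfDist (G q) (F q.2)
        ∂((Measure.pi fun _ : Fin n => (P : Measure (Cov k × ℝ))).prod
          (P : Measure (Cov k × ℝ)).fst) := by
        rw [lintegral_prod_symm' _ hfm, hfst, lintegral_gridMeasure]
        refine Finset.sum_congr rfl fun g _ => ?_
        congr 1
        have hpi : (Measure.pi fun _ : Fin n => (P : Measure (Cov k × ℝ)))
            = (Measure.pi fun _ : Fin n => cellMeasure δ σ).map fun ω i => cellPoint b (ω i) := by
          rw [hmap]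
          exact (Measure.pi_map_pi (f := fun _ : Fin n => cellPoint b)
            fun _ => hcm.aemeasurable).symm
        have hm1 : Measurable fun (ω : Fin n → (Fin k → Fin m) × Bool) i => cellPoint b (ω i) :=
          .of_discrete
        have hm2 : Measurable fun s : Fin n → Cov k × ℝ =>
            cdfDist (G (s, gridPoint g)) (F (gridPoint g)) :=
          hfm.comp (measurable_prodMk_right (y := gridPoint g))
        rw [hpi, lintegral_map hm2 hm1, lintegral_fintype]
        refine Finset.sum_congr rfl fun ω _ => ?_
        rw [Measure.pi_singleton, mul_comm, ENNReal.ofReal_prod_of_nonneg fun i _ =>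
          cellProb_nonneg σ hδ hδ1 _]
        simp_rw [cellMeasure_singleton]
        rw [hF, perturbedKernel_apply, envelope_gridPoint σ hδ hc hH hδc]
    _ ≤ _ := by
        refine lintegral_mono_ae ?_
        filter_upwards [hcond2] with q hq
        rw [← hq]
        exact cdfDist_le_W1 _ _

end submodel

/-! ### Lower bounds for the worst-case risk -/

/-- The total overlap of two product distributions in terms of the affinity of the factors. -/
lemma affinity_pow_le_sum_min {Ω : Type*} [Fintype Ω] {p q : Ω → ℝ} (hp : ∀ a, 0 ≤ p a)
    (hq : ∀ a, 0 ≤ q a) (hp1 : ∑ a, p a = 1) (hq1 : ∑ a, q a = 1) (n : ℕ) :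
    ((∑ a, √(p a * q a)) ^ n) ^ 2 / 2
      ≤ ∑ ω : Fin n → Ω, min (∏ i, p (ω i)) (∏ i, q (ω i)) := by
  classical
  have hP0 : ∀ ω : Fin n → Ω, 0 ≤ ∏ i, p (ω i) := fun ω => Finset.prod_nonneg fun i _ => hp _
  have hQ0 : ∀ ω : Fin n → Ω, 0 ≤ ∏ i, q (ω i) := fun ω => Finset.prod_nonneg fun i _ => hq _
  have hpow : ∀ f : Ω → ℝ, (∑ a, f a) ^ n = ∑ ω : Fin n → Ω, ∏ i, f (ω i) := by
    intro f
    have := Finset.prod_univ_sum (fun _ : Fin n => (Finset.univ : Finset Ω)) fun _ a => f a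
    simpa using this
  have hmax : ∑ ω : Fin n → Ω, max (∏ i, p (ω i)) (∏ i, q (ω i)) ≤ 2 := by
    calc _ ≤ ∑ ω : Fin n → Ω, (∏ i, p (ω i) + ∏ i, q (ω i)) :=
          Finset.sum_le_sum fun ω _ => max_le_add_of_nonneg (hP0 ω) (hQ0 ω)
      _ = 2 := by
          rw [Finset.sum_add_distrib, ← hpow, ← hpow, hp1, hq1]
          norm_num
  have hmin0 : 0 ≤ ∑ ω : Fin n → Ω, min (∏ i, p (ω i)) (∏ i, q (ω i)) :=
    Finset.sum_nonneg fun ω _ => le_min (hP0 ω) (hQ0 ω)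
  -- The affinity of the products is the `n`-th power. Splitting `√(pq)` as `√min * √max` and
  -- applying Cauchy–Schwarz leaves `∑ max ≤ 2` as the price.
  have hCS : (∑ a, √(p a * q a)) ^ n
      ≤ √(∑ ω : Fin n → Ω, min (∏ i, p (ω i)) (∏ i, q (ω i))) *
        √(∑ ω : Fin n → Ω, max (∏ i, p (ω i)) (∏ i, q (ω i))) := by
    rw [hpow]
    refine le_trans (le_of_eq (Finset.sum_congr rfl fun ω _ => ?_))
      (Real.sum_sqrt_mul_sqrt_le _ (fun ω => le_min (hP0 ω) (hQ0 ω))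
        fun ω => (hP0 ω).trans (le_max_left _ _))
    rw [← Real.sqrt_mul (le_min (hP0 ω) (hQ0 ω)), min_mul_max, ← Finset.prod_mul_distrib,
      Real.sqrt_prod _ fun i _ => mul_nonneg (hp _) (hq _)]
  have h0 : 0 ≤ (∑ a, √(p a * q a)) ^ n :=
    pow_nonneg (Finset.sum_nonneg fun a _ => Real.sqrt_nonneg _) n
  have h2 := pow_le_pow_left₀ h0 hCS 2
  rw [mul_pow, Real.sq_sqrt hmin0, Real.sq_sqrt (hmin0.trans (Finset.sum_le_sum fun ω _ =>
    min_le_max))] at h2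
  rw [div_le_iff₀ two_pos]
  exact h2.trans (mul_le_mul_of_nonneg_left hmax hmin0)

lemma sum_cellProb {k m : ℕ} [NeZero m] (δ : ℝ) (σ : (Fin k → Fin m) → Bool) :
    ∑ a, cellProb δ σ a = 1 := by
  have hm : (m : ℝ) ≠ 0 := NeZero.ne _
  rw [Fintype.sum_prod_type]
  have : ∀ g : Fin k → Fin m, ∑ b, cellProb δ σ (g, b) = 1 / (m : ℝ) ^ k := fun g => by
    rw [Fintype.sum_bool]
    simp only [cellProb, boolSign]
    simp only [if_true, Bool.false_eq_true, if_false]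
    ring
  simp only [this]
  simp [hm]

/-- Changing one sign hardly changes the distribution of an observation. -/
lemma one_sub_le_affinity_cellProb {k m : ℕ} [NeZero m] {δ : ℝ} (hδ : 0 ≤ δ) (hδ1 : δ ≤ 1 / 4)
    (σ : (Fin k → Fin m) → Bool) (g : Fin k → Fin m) :
    1 - 4 * δ ^ 2 / (m : ℝ) ^ k
      ≤ ∑ a, √(cellProb δ σ a * cellProb δ (Function.update σ g (!σ g)) a) := by
  have hm : (0 : ℝ) < m := by exact_mod_cast NeZero.pos m
  have hmk : (0 : ℝ) < (m : ℝ) ^ k := by positivity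
  -- Cells away from `g` keep their full mass. The two cells at `g` each have affinity `√(1 - 4δ²) /
  -- (2 m^k)`, bounded below by `√x ≥ x` on the unit interval; together they lose at most `4δ² /
  -- m^k`.
  have hcell : ∀ a : (Fin k → Fin m) × Bool,
      cellProb δ σ a - (if a.1 = g then cellProb δ σ a - 1 / (m : ℝ) ^ k * ((1 - 4 * δ ^ 2) / 2)
        else 0) ≤ √(cellProb δ σ a * cellProb δ (Function.update σ g (!σ g)) a) := by
    rintro ⟨g', b⟩
    by_cases h : g' = g
    · subst h
      rw [if_pos rfl, sub_sub_cancel]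
      refine Real.le_sqrt_of_sq_le ?_
      have hs : (boolSign (σ g') * boolSign b) ^ 2 = 1 := by
        cases σ g' <;> cases b <;> simp [boolSign]
      simp only [cellProb, Function.update_self, boolSign_not]
      have h4 : (1 - 4 * δ ^ 2) ^ 2 ≤ 1 - 4 * δ ^ 2 := by
        have h5 : 4 * δ ^ 2 ≤ 1 := by nlinarith
        nlinarith [mul_nonneg (by positivity : 0 ≤ 4 * δ ^ 2) (sub_nonneg.2 h5)]
      have : 1 / (m : ℝ) ^ k * (1 / 2 + boolSign (σ g') * boolSign b * δ) *
          (1 / (m : ℝ) ^ k * (1 / 2 + -boolSign (σ g') * boolSign b * δ))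
          = (1 / (m : ℝ) ^ k) ^ 2 * ((1 - 4 * δ ^ 2) / 4) := by
        linear_combination (-(1 / (m : ℝ) ^ k) ^ 2 * δ ^ 2) * hs
      rw [this, mul_pow]
      gcongr
      linarith
    · have h2 : cellProb δ (Function.update σ g (!σ g)) (g', b) = cellProb δ σ (g', b) := by
        simp only [cellProb, Function.update_of_ne h]
      rw [if_neg h, sub_zero, h2, Real.sqrt_mul_self (cellProb_nonneg σ hδ hδ1 _)]
  refine le_trans (le_of_eq ?_) (Finset.sum_le_sum fun a _ => hcell a)
  rw [Finset.sum_sub_distrib, sum_cellProb, Fintype.sum_prod_type]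
  have h1 : ∀ g' : Fin k → Fin m, ∑ b, (if ((g', b) : (Fin k → Fin m) × Bool).1 = g then
      cellProb δ σ (g', b) - 1 / (m : ℝ) ^ k * ((1 - 4 * δ ^ 2) / 2) else 0)
      = if g' = g then 4 * δ ^ 2 / (m : ℝ) ^ k else 0 := fun g' => by
    by_cases h : g' = g
    · simp only [h, if_true, Fintype.sum_bool, cellProb, boolSign, Bool.false_eq_true, if_false]
      ring
    · simp [h]
  simp only [h1]
  simp

/-- With `x = 4δ² / m^k` the sample size condition says `n x ≤ 1/4`, so Bernoulli's inequality
bounds the squared affinity `(1 - x)^(2n)` below by `1/2`. -/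
lemma quarter_le_sum_min_cellProb {k m n : ℕ} [NeZero m] {δ : ℝ} (hδ : 0 ≤ δ) (hδ1 : δ ≤ 1 / 4)
    (hn : 16 * n * δ ^ 2 ≤ (m : ℝ) ^ k) (σ : (Fin k → Fin m) → Bool) (g : Fin k → Fin m) :
    1 / 4 ≤ ∑ ω : Fin n → (Fin k → Fin m) × Bool, min (∏ i, cellProb δ σ (ω i))
      (∏ i, cellProb δ (Function.update σ g (!σ g)) (ω i)) := by
  have hm : (0 : ℝ) < m := by exact_mod_cast NeZero.pos m
  have hmk : (1 : ℝ) ≤ (m : ℝ) ^ k := one_le_pow₀ (by exact_mod_cast NeZero.one_le)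
  refine le_trans ?_ (affinity_pow_le_sum_min (cellProb_nonneg σ hδ hδ1)
    (cellProb_nonneg _ hδ hδ1) (sum_cellProb δ σ) (sum_cellProb δ _) n)
  set x : ℝ := 4 * δ ^ 2 / (m : ℝ) ^ k with hx
  have hx1 : x ≤ 1 := by
    rw [hx, div_le_one (by positivity)]
    nlinarith
  have h1 := pow_le_pow_left₀ (by linarith) (one_sub_le_affinity_cellProb hδ hδ1 σ g) (n * 2)
  have h2 := one_add_mul_le_pow (a := -x) (by linarith) (n * 2)
  have h3 : n * x ≤ 1 / 4 := by
    rw [hx, ← mul_div_assoc, div_le_iff₀ (by positivity)]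
    linarith
  rw [← pow_mul]
  push_cast at h2
  rw [← sub_eq_add_neg] at h2
  linarith

/-- The average over all sign patterns of the errors in testing the individual signs. -/
lemma le_sum_sign_patterns {k m n : ℕ} [NeZero m] {δ : ℝ} (hδ : 0 ≤ δ) (hδ1 : δ ≤ 1 / 4)
    (hn : 16 * n * δ ^ 2 ≤ (m : ℝ) ^ k) {Δ : ℝ≥0∞}
    {D : (Fin n → (Fin k → Fin m) × Bool) → (Fin k → Fin m) → Bool → ℝ≥0∞}
    (hD : ∀ ω g, Δ ≤ D ω g true + D ω g false) :
    (Fintype.card ((Fin k → Fin m) → Bool) : ℝ≥0∞) * (Δ * ENNReal.ofReal (1 / 4)) ≤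
      2 * ∑ σ : (Fin k → Fin m) → Bool, ∑ g : Fin k → Fin m, ENNReal.ofReal (1 / (m : ℝ) ^ k) *
        ∑ ω : Fin n → (Fin k → Fin m) × Bool,
          ENNReal.ofReal (∏ i, cellProb δ σ (ω i)) * D ω g (σ g) := by
  set A : (Fin k → Fin m) → ((Fin k → Fin m) → Bool) → ℝ≥0∞ := fun g σ =>
    ∑ ω : Fin n → (Fin k → Fin m) × Bool,
      ENNReal.ofReal (∏ i, cellProb δ σ (ω i)) * D ω g (σ g) with hA
  -- Le Cam's two-point argument: on the common part of the two sample distributions the two errors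
  -- together amount to at least `Δ`.
  have hpair : ∀ g σ, Δ * ENNReal.ofReal (1 / 4) ≤ A g σ + A g (Function.update σ g (!σ g)) := by
    intro g σ
    have hq := quarter_le_sum_min_cellProb (n := n) hδ hδ1 hn σ g
    have hmin0 : ∀ ω : Fin n → (Fin k → Fin m) × Bool, 0 ≤ min (∏ i, cellProb δ σ (ω i))
        (∏ i, cellProb δ (Function.update σ g (!σ g)) (ω i)) := fun ω =>
      le_min (Finset.prod_nonneg fun i _ => cellProb_nonneg σ hδ hδ1 _)
        (Finset.prod_nonneg fun i _ => cellProb_nonneg _ hδ hδ1 _)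
    calc Δ * ENNReal.ofReal (1 / 4)
        ≤ Δ * ∑ ω : Fin n → (Fin k → Fin m) × Bool, ENNReal.ofReal (min (∏ i, cellProb δ σ (ω i))
            (∏ i, cellProb δ (Function.update σ g (!σ g)) (ω i))) := by
          rw [← ENNReal.ofReal_sum_of_nonneg fun ω _ => hmin0 ω]
          gcongr
      _ ≤ ∑ ω : Fin n → (Fin k → Fin m) × Bool, (ENNReal.ofReal (∏ i, cellProb δ σ (ω i)) *
            D ω g (σ g) + ENNReal.ofReal (∏ i, cellProb δ (Function.update σ g (!σ g)) (ω i)) *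
            D ω g (!σ g)) := by
          rw [Finset.mul_sum]
          refine Finset.sum_le_sum fun ω _ => ?_
          have hΔ : Δ ≤ D ω g (σ g) + D ω g (!σ g) := by
            cases σ g
            · simpa [add_comm] using hD ω g
            · simpa using hD ω g
          rw [mul_comm]
          refine (mul_le_mul_right hΔ _).trans ?_
          rw [mul_add]
          gcongr
          · exact min_le_left _ _
          · exact min_le_right _ _
      _ = A g σ + A g (Function.update σ g (!σ g)) := by
          rw [Finset.sum_add_distrib]
          simp only [hA, Function.update_self]
  -- Flipping is an involution on sign patterns, so the average of the paired errors is twice the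
  -- average error.
  have hflip : ∀ g, ∑ σ, A g (Function.update σ g (!σ g)) = ∑ σ, A g σ := by
    intro g
    have hinv : Function.Involutive fun σ : (Fin k → Fin m) → Bool =>
        Function.update σ g (!σ g) := fun σ => by simp
    exact Equiv.sum_comp (hinv.toPerm _) (A g)
  have hg : ∀ g, (Fintype.card ((Fin k → Fin m) → Bool) : ℝ≥0∞) * (Δ * ENNReal.ofReal (1 / 4))
      ≤ 2 * ∑ σ, A g σ := by
    intro g
    calc _ = ∑ _σ : (Fin k → Fin m) → Bool, Δ * ENNReal.ofReal (1 / 4) := by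
          rw [Finset.sum_const, nsmul_eq_mul, Finset.card_univ]
      _ ≤ ∑ σ, (A g σ + A g (Function.update σ g (!σ g))) :=
          Finset.sum_le_sum fun σ _ => hpair g σ
      _ = 2 * ∑ σ, A g σ := by rw [Finset.sum_add_distrib, hflip, two_mul]
  have hN : ∑ _g : Fin k → Fin m, ENNReal.ofReal (1 / (m : ℝ) ^ k) = 1 := by
    have hm : (m : ℝ) ≠ 0 := NeZero.ne _
    rw [← ENNReal.ofReal_sum_of_nonneg fun _ _ => by positivity]
    simp [hm]
  rw [Finset.sum_comm]
  simp_rw [← Finset.mul_sum]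
  calc _ = ∑ _g : Fin k → Fin m, ENNReal.ofReal (1 / (m : ℝ) ^ k) *
        ((Fintype.card ((Fin k → Fin m) → Bool) : ℝ≥0∞) * (Δ * ENNReal.ofReal (1 / 4))) := by
        rw [← Finset.sum_mul, hN, one_mul]
    _ ≤ ∑ g : Fin k → Fin m, ENNReal.ofReal (1 / (m : ℝ) ^ k) * (2 * ∑ σ, A g σ) := by
        exact Finset.sum_le_sum fun g _ => mul_le_mul' le_rfl (hg g)
    _ = 2 * (ENNReal.ofReal (1 / (m : ℝ) ^ k) * ∑ g : Fin k → Fin m, ∑ σ, A g σ) := by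
        simp_rw [mul_left_comm _ (2 : ℝ≥0∞), ← Finset.mul_sum]

/-- A lower bound for the worst-case risk of any randomised estimator. -/
lemma le_maxRiskRand {k m n : ℕ} [NeZero m] {H L M δ : ℝ} (hH : 0 < H) (hH1 : H ≤ 1)
    (hL : 0 < L) (hM : 0 < M) (hδ : 0 ≤ δ) (hδ1 : δ ≤ 1 / 4)
    (hδc : 2 * δ ≤ L / M * (1 / (m : ℝ)) ^ H) (hn : 16 * n * δ ^ 2 ≤ (m : ℝ) ^ k)
    {T : Type} [MeasurableSpace T] (ν : Measure T) [IsProbabilityMeasure ν] {G : T → Rule k n}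
    (hGm : Measurable fun p : T × ((Fin n → Cov k × ℝ) × Cov k) => G p.1 p.2)
    (hG1 : ∀ t q, IsProbabilityMeasure (G t q)) :
    ENNReal.ofReal (M * δ / 4) ≤ maxRiskRand ν H L M G := by
  have hLM : 0 ≤ L / M := by positivity
  have hGe : ∀ t, IsEstimator (G t) := fun t => ⟨hGm.comp measurable_prodMk_left, hG1 t⟩
  have hp : ∀ b : Bool, 0 ≤ 1 / 2 + boolSign b * δ ∧ 1 / 2 + boolSign b * δ ≤ 1 := fun b => by
    have h1 := neg_one_le_boolSign b
    have h2 := boolSign_le_one b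
    constructor <;> nlinarith
  have htp : ∀ b : Bool, IsProbabilityMeasure (twoPoint M (1 / 2 + boolSign b * δ)) := fun b =>
    isProbabilityMeasure_twoPoint M (hp b).1 (hp b).2
  let D : T → (Fin n → (Fin k → Fin m) × Bool) → (Fin k → Fin m) → Bool → ℝ≥0∞ := fun t ω g b =>
    cdfDist (G t (fun i => cellPoint M (ω i), gridPoint g)) (twoPoint M (1 / 2 + boolSign b * δ))
  have hDm : ∀ ω g b, Measurable fun t => D t ω g b := fun ω g b =>
    measurable_cdfDist (hGm.comp measurable_prodMk_right) measurable_const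
      (fun t => hG1 t _) fun _ => htp b
  have hΔ : ∀ t ω g, ENNReal.ofReal (M * (2 * δ)) ≤ D t ω g true + D t ω g false := by
    intro t ω g
    have h1 := cdfDist_twoPoint hM.le (hp true).1 (hp true).2 (hp false).1 (hp false).2
    have h2 : |1 / 2 + boolSign true * δ - (1 / 2 + boolSign false * δ)| = 2 * δ := by
      simp only [boolSign, if_true, Bool.false_eq_true, if_false]
      rw [abs_of_nonneg (by linarith)]
      ring
    rw [h2] at h1
    have := hG1 t (fun i => cellPoint M (ω i), gridPoint g)
    rw [← h1]
    refine (cdfDist_triangle _ (G t (fun i => cellPoint M (ω i), gridPoint g)) _).trans ?_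
    rw [cdfDist_comm]
  set R : ((Fin k → Fin m) → Bool) → T → ℝ≥0∞ := fun σ t =>
    ∑ g : Fin k → Fin m, ENNReal.ofReal (1 / (m : ℝ) ^ k) *
      ∑ ω : Fin n → (Fin k → Fin m) × Bool,
        ENNReal.ofReal (∏ i, cellProb δ σ (ω i)) * D t ω g (σ g) with hR
  have hRm : ∀ σ, Measurable (R σ) := fun σ =>
    Finset.measurable_sum _ fun g _ => (Finset.measurable_sum _ fun ω _ =>
      (hDm ω g _).const_mul _).const_mul _
  have hRle : ∀ σ, ∫⁻ t, R σ t ∂ν ≤ maxRiskRand ν H L M G := by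
    intro σ
    refine le_trans (lintegral_mono fun t => ?_) (le_iSup₂ (f := fun P _ => ∫⁻ t, risk P (G t) ∂ν)
      (perturbedLaw M hδ hδ1 hLM hH σ) (perturbedLaw_mem_classD σ hM hδ hδ1 hLM hH hH1 hδc))
    exact le_risk_perturbedLaw σ hδ hδ1 hLM hH hδc (hGe t)
  set N : ℝ≥0∞ := (Fintype.card ((Fin k → Fin m) → Bool) : ℝ≥0∞) with hN
  have hN0 : N ≠ 0 := by
    rw [hN]
    exact_mod_cast Fintype.card_ne_zero
  have hNt : N ≠ ⊤ := ENNReal.natCast_ne_top _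
  -- The worst case dominates the average over sign patterns. Averaging under the integral over `t`
  -- lets the deterministic bound apply for each value of the auxiliary variable.
  have hfin : N * ENNReal.ofReal (M * δ / 4) * 2 ≤ N * maxRiskRand ν H L M G * 2 := by
    calc N * ENNReal.ofReal (M * δ / 4) * 2
        = ∫⁻ _t, N * (ENNReal.ofReal (M * (2 * δ)) * ENNReal.ofReal (1 / 4)) ∂ν := by
          rw [lintegral_const, measure_univ, mul_one, mul_assoc,
            ← ENNReal.ofReal_mul (by positivity), ← ENNReal.ofReal_ofNat,
            ← ENNReal.ofReal_mul (by positivity)]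
          ring_nf
      _ ≤ ∫⁻ t, 2 * ∑ σ, R σ t ∂ν :=
          lintegral_mono fun t => le_sum_sign_patterns hδ hδ1 hn (hΔ t)
      _ = 2 * ∑ σ, ∫⁻ t, R σ t ∂ν := by
          rw [lintegral_const_mul _ (Finset.measurable_sum _ fun σ _ => hRm σ),
            lintegral_finsetSum _ fun σ _ => hRm σ]
      _ ≤ 2 * ∑ _σ : (Fin k → Fin m) → Bool, maxRiskRand ν H L M G := by
          gcongr with σ
          exact hRle σ
      _ = N * maxRiskRand ν H L M G * 2 := by
          rw [Finset.sum_const, nsmul_eq_mul, Finset.card_univ, mul_comm]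
  have h2 := (ENNReal.mul_le_mul_iff_left two_ne_zero ENNReal.ofNat_ne_top).1 hfin
  exact (ENNReal.mul_le_mul_iff_right hN0 hNt).1 h2

/-! ### Rates -/

/-- The number `r` is the scale at which the bias `r ^ H` equals the stochastic error `(n
r^k)^(-1/2)`. The last identity identifies the order of the neighbour number with `n r^k`. -/
lemma rate_facts {k n : ℕ} {H : ℝ} (hH : 0 < H) (hn : 1 ≤ n) :
    ∃ r : ℝ, 0 < r ∧ r ≤ 1 ∧ (n : ℝ) ^ (-1 / (2 * H + k)) = r ∧
      (n : ℝ) ^ (-H / (2 * H + k)) = r ^ H ∧ n * r ^ k * (r ^ H) ^ 2 = 1 ∧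
      (n : ℝ) ^ (H / (H + (k : ℝ) / 2)) = n * r ^ k := by
  have hn0 : (0 : ℝ) < n := by exact_mod_cast hn
  have hn1 : (1 : ℝ) ≤ n := by exact_mod_cast hn
  have hd : 0 < 2 * H + k := by positivity
  have hrk : ((n : ℝ) ^ (-1 / (2 * H + k))) ^ k = (n : ℝ) ^ (-k / (2 * H + k)) := by
    rw [← Real.rpow_natCast, ← Real.rpow_mul hn0.le]
    congr 1
    ring
  have hrH : ((n : ℝ) ^ (-1 / (2 * H + k))) ^ H = (n : ℝ) ^ (-H / (2 * H + k)) := by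
    rw [← Real.rpow_mul hn0.le]
    congr 1
    ring
  refine ⟨(n : ℝ) ^ (-1 / (2 * H + k)), by positivity,
    Real.rpow_le_one_of_one_le_of_nonpos hn1 ?_, rfl, hrH.symm, ?_, ?_⟩
  · rw [neg_div]
    have : 0 ≤ 1 / (2 * H + k) := by positivity
    linarith
  · rw [hrk, hrH, ← Real.rpow_natCast _ 2, ← Real.rpow_mul hn0.le]
    nth_rewrite 1 [← Real.rpow_one (n : ℝ)]
    rw [← Real.rpow_add hn0, ← Real.rpow_add hn0]
    convert Real.rpow_zero (n : ℝ) using 2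
    push_cast
    field_simp
    ring
  · rw [hrk]
    nth_rewrite 2 [← Real.rpow_one (n : ℝ)]
    rw [← Real.rpow_add hn0]
    congr 1
    field_simp
    ring

lemma le_mul_of_ofReal_le {a b : ℝ} {C : ℝ≥0} (hb : 0 ≤ b)
    (h : ENNReal.ofReal a ≤ C * ENNReal.ofReal b) : a ≤ C * b := by
  rw [← ENNReal.ofReal_coe_nnreal, ← ENNReal.ofReal_mul C.coe_nonneg] at h
  exact (ENNReal.ofReal_le_ofReal_iff (by positivity)).1 h

lemma sameRate_of_bounds {f : ℕ → ℝ≥0∞} {g : ℕ → ℝ} {c C : ℝ} (hc : 0 < c)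
    (hg : ∀ n, 0 ≤ g n) (hl : ∀ᶠ n in atTop, ENNReal.ofReal (c * g n) ≤ f n)
    (hu : ∀ᶠ n in atTop, f n ≤ ENNReal.ofReal (C * g n)) :
    SameRate f fun n => ENNReal.ofReal (g n) := by
  refine ⟨max C.toNNReal (1 / c).toNNReal, ?_⟩
  filter_upwards [hl, hu] with n h1 h2
  constructor
  · refine h2.trans ?_
    rw [ENNReal.ofReal_mul' (hg n)]
    gcongr
    exact ENNReal.coe_le_coe.2 (le_max_left _ _)
  · calc ENNReal.ofReal (g n) = ENNReal.ofReal (1 / c) * ENNReal.ofReal (c * g n) := by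
          rw [← ENNReal.ofReal_mul (by positivity)]
          congr 1
          field_simp
      _ ≤ _ := by
          gcongr
          exact ENNReal.coe_le_coe.2 (le_max_right _ _)

/-- No randomised estimator beats the minimax rate. -/
lemma exists_rate_le_maxRiskRand (k : ℕ) {H L M : ℝ} (hH : 0 < H) (hH1 : H ≤ 1) (hL : 0 < L)
    (hM : 0 < M) : ∃ c : ℝ, 0 < c ∧ ∀ n : ℕ, 1 ≤ n → ∀ (T : Type) [MeasurableSpace T]
      (ν : Measure T) [IsProbabilityMeasure ν] (G : T → Rule k n),
      (Measurable fun p : T × ((Fin n → Cov k × ℝ) × Cov k) => G p.1 p.2) →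
      (∀ t q, IsProbabilityMeasure (G t q)) →
      ENNReal.ofReal (c * (n : ℝ) ^ (-H / (2 * H + k))) ≤ maxRiskRand ν H L M G := by
  -- The first entry keeps the success probabilities in range and, through `16 * c₀ ^ 2 ≤ 1`, gives
  -- the sample size condition; the second gives the Hölder condition.
  set c₀ : ℝ := min (1 / 4) (L / (2 * M)) with hc₀
  have hc₀0 : 0 < c₀ := lt_min (by norm_num) (by positivity)
  have hc₀1 : c₀ ≤ 1 / 4 := min_le_left _ _
  have hc₀2 : 2 * c₀ ≤ L / M := by
    have := min_le_right (1 / 4) (L / (2 * M))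
    calc 2 * c₀ ≤ 2 * (L / (2 * M)) := by linarith
      _ = L / M := by field_simp
  -- The 8 is the 4 of `le_maxRiskRand` times a factor 2 for rounding `1 / r` up to an integer,
  -- which at most doubles it.
  refine ⟨M * c₀ / 8, by positivity, fun n hn T _ ν _ G hGm hG1 => ?_⟩
  obtain ⟨r, hr0, hr1, -, hrH, hrn, -⟩ := rate_facts (k := k) hH hn
  rw [hrH]
  set m : ℕ := ⌈1 / r⌉₊ with hm
  have hm1 : 1 / r ≤ m := Nat.le_ceil _
  have hr1' : 1 ≤ 1 / r := (one_le_div hr0).2 hr1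
  have hm2 : (m : ℝ) ≤ 2 / r := by
    have := Nat.ceil_lt_add_one (zero_le_one.trans hr1')
    calc (m : ℝ) ≤ 1 / r + 1 / r := by linarith
      _ = 2 / r := by ring
  have hm0 : (0 : ℝ) < m := lt_of_lt_of_le (by positivity) hm1
  have : NeZero m := ⟨by exact_mod_cast hm0.ne'⟩
  have hmr : 1 / (m : ℝ) ≤ r := by rwa [div_le_comm₀ hm0 hr0]
  set v : ℝ := (1 / (m : ℝ)) ^ H with hv
  have hv0 : 0 < v := by positivity
  have hvr : v ≤ r ^ H := Real.rpow_le_rpow (by positivity) hmr hH.le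
  have hv1 : v ≤ 1 := hvr.trans (Real.rpow_le_one hr0.le hr1 hH.le)
  have hvl : r ^ H / 2 ≤ v := by
    have h1 : r / 2 ≤ 1 / m := by
      rw [le_div_iff₀ hm0]
      calc r / 2 * m ≤ r / 2 * (2 / r) := by gcongr
        _ = 1 := by field_simp
    have h2 := Real.rpow_le_rpow (by positivity) h1 hH.le
    rw [Real.div_rpow hr0.le (by norm_num)] at h2
    refine le_trans ?_ h2
    gcongr
    simpa using Real.rpow_le_rpow_of_exponent_le (x := 2) (by norm_num) hH1
  refine le_trans (ENNReal.ofReal_le_ofReal ?_) (le_maxRiskRand (m := m) (δ := c₀ * v) hH hH1 hL hM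
    (by positivity) (by nlinarith) ?_ ?_ ν hGm hG1)
  · have : M * c₀ * (r ^ H / 2) ≤ M * c₀ * v := by gcongr
    linarith
  · rw [← mul_assoc]
    gcongr
  · have hn0 : (0 : ℝ) < n := by exact_mod_cast hn
    have h1 : (c₀ * v) ^ 2 ≤ (r ^ H) ^ 2 / 16 := by
      calc (c₀ * v) ^ 2 ≤ (1 / 4 * r ^ H) ^ 2 := by gcongr
        _ = _ := by ring
    have h2 : n * (r ^ H) ^ 2 = (1 / r) ^ k := by
      rw [one_div, inv_pow]
      refine eq_inv_of_mul_eq_one_left ?_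
      rw [← hrn]
      ring
    calc 16 * n * (c₀ * v) ^ 2 ≤ 16 * n * ((r ^ H) ^ 2 / 16) := by gcongr
      _ = (1 / r) ^ k := by rw [← h2]; ring
      _ ≤ (m : ℝ) ^ k := by gcongr

/-- A deterministic rule is a randomised one with trivial randomness, so one lower bound serves both
cases. -/
lemma maxRiskRand_dirac {k n : ℕ} (H L M : ℝ) (G : Rule k n) :
    maxRiskRand (Measure.dirac ()) H L M (fun _ => G) = maxRisk H L M G := by
  simp [maxRiskRand, maxRisk]

lemma exists_rate_le_maxRisk (k : ℕ) {H L M : ℝ} (hH : 0 < H) (hH1 : H ≤ 1) (hL : 0 < L)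
    (hM : 0 < M) : ∃ c : ℝ, 0 < c ∧ ∀ n : ℕ, 1 ≤ n → ∀ G : Rule k n, IsEstimator G →
      ENNReal.ofReal (c * (n : ℝ) ^ (-H / (2 * H + k))) ≤ maxRisk H L M G := by
  obtain ⟨c, hc, h⟩ := exists_rate_le_maxRiskRand k hH hH1 hL hM
  refine ⟨c, hc, fun n hn G hG => ?_⟩
  rw [← maxRiskRand_dirac]
  exact h n hn Unit (Measure.dirac ()) (fun _ => G) (hG.1.comp measurable_snd) fun _ => hG.2

lemma isEstimator_kernelRule {k n : ℕ} (hn : 1 ≤ n) {K : Cov k → ℝ} (hK : Measurable K)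
    (hK0 : ∀ x, 0 ≤ K x) (h : ℝ) : IsEstimator (kernelRule n K h) := by
  refine ⟨measurable_weightedEmpirical (fun i => ?_) fun i => by fun_prop, fun q =>
    isProbabilityMeasure_weightedEmpirical (kernelWeight_nonneg hK0 _ _ _)
      (sum_kernelWeight hn K _ _ _) _⟩
  have hKi : ∀ j : Fin n, Measurable fun q : (Fin n → Cov k × ℝ) × Cov k =>
      K (h⁻¹ • (q.2 - (q.1 j).1)) := fun j => hK.comp (by fun_prop)
  have hsum := Finset.measurable_sum Finset.univ fun j _ => hKi j
  unfold kernelWeight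
  refine Measurable.ite ?_ measurable_const ((hKi i).div hsum)
  exact hsum (measurableSet_singleton 0)

/-- The kernel method attains the rate `n ^ (-H / (2 * H + k))`. -/
lemma exists_maxRisk_kernelRule_le (k : ℕ) {H L M : ℝ} (hH : 0 < H) (hL : 0 < L) (hM : 0 < M)
    {K : Cov k → ℝ} (hK : IsBoxedKernel K) {a A : ℝ} (ha : 0 < a) (hA : 0 ≤ A) :
    ∃ C : ℝ, ∀ n : ℕ, 1 ≤ n → ∀ h : ℝ, a * (n : ℝ) ^ (-1 / (2 * H + k)) ≤ h →
      h ≤ A * (n : ℝ) ^ (-1 / (2 * H + k)) →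
      maxRisk H L M (kernelRule n K h) ≤ ENNReal.ofReal (C * (n : ℝ) ^ (-H / (2 * H + k))) := by
  obtain ⟨hKm, R₁, R₂, M₁, M₂, hR₁, hR, hM₁, hM₂, hbox⟩ := hK
  have hR₂ : 0 < R₂ := hR₁.trans_le hR
  set D : ℝ := L * √k ^ H + √(2 * M₂ / M₁) * M with hD
  -- The grid size is `⌈√k / (R₁ * h)⌉₊ + 1`, at least 1 in every case. Rounding, this added one and
  -- the one in `m + 1` give the 3.
  set Q : ℝ := √k / (R₁ * a) + 3 with hQ
  refine ⟨L * (R₂ * A) ^ H + D * √(Q ^ k), fun n hn h hah hhA => iSup₂_le fun P hP => ?_⟩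
  obtain ⟨r, hr0, hr1, hr, hrH, hrn, -⟩ := rate_facts (k := k) hH hn
  rw [hr] at hah hhA
  rw [hrH]
  have hh : 0 < h := lt_of_lt_of_le (by positivity) hah
  have hn0 : (0 : ℝ) < n := by exact_mod_cast hn
  have hm1 : √k / (R₁ * h) ≤ (⌈√k / (R₁ * h)⌉₊ + 1 : ℕ) := by
    have := Nat.le_ceil (√k / (R₁ * h))
    push_cast
    linarith
  refine (risk_kernelRule_le hn (m := ⌈√k / (R₁ * h)⌉₊ + 1) (Nat.le_add_left 1 _) hH hL hM hKm hR hR₁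
    hM₁ hM₂ hbox hh ?_ hP).trans (ENNReal.ofReal_le_ofReal ?_)
  · rw [div_le_comm₀ (by positivity) (by positivity)]
    exact hm1
  · have hmQ : ((⌈√k / (R₁ * h)⌉₊ + 1 : ℕ) : ℝ) + 1 ≤ Q / r := by
      have h1 := Nat.ceil_lt_add_one (a := √k / (R₁ * h)) (by positivity)
      have h2 : √k / (R₁ * h) ≤ √k / (R₁ * (a * r)) := by gcongr
      have h3 : (3 : ℝ) ≤ 3 / r := by
        rw [le_div_iff₀ hr0]
        linarith
      have h4 : Q / r = √k / (R₁ * (a * r)) + 3 / r := by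
        rw [hQ, add_div, div_div, mul_assoc]
      push_cast
      rw [h4]
      linarith
    have hcell : (((⌈√k / (R₁ * h)⌉₊ + 1 : ℕ) : ℝ) + 1) ^ k / (n + 1) ≤ Q ^ k * (r ^ H) ^ 2 := by
      have h5 : (r ^ H) ^ 2 = 1 / (r ^ k * n) := by
        rw [eq_div_iff (by positivity), ← hrn]
        ring
      calc _ ≤ (Q / r) ^ k / n := by
            gcongr
            linarith
        _ = Q ^ k * (r ^ H) ^ 2 := by
            rw [h5, div_pow, div_div, ← mul_div_assoc, mul_one]
    have hsq : √((((⌈√k / (R₁ * h)⌉₊ + 1 : ℕ) : ℝ) + 1) ^ k / (n + 1)) ≤ √(Q ^ k) * r ^ H := by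
      refine (Real.sqrt_le_sqrt hcell).trans (le_of_eq ?_)
      rw [Real.sqrt_mul (by positivity), Real.sqrt_sq (by positivity)]
    have hRh : (R₂ * h) ^ H ≤ (R₂ * A) ^ H * r ^ H := by
      rw [← Real.mul_rpow (by positivity) hr0.le, mul_assoc]
      gcongr
    calc _ ≤ L * ((R₂ * A) ^ H * r ^ H) + D * (√(Q ^ k) * r ^ H) := by gcongr
      _ = _ := by ring

lemma isProbabilityMeasure_nnRule {k n κ : ℕ} (hκ : 1 ≤ κ) {T : Type} [MeasurableSpace T]
    {S : T × (Fin n → Cov k) × Cov k → Finset (Fin n)} (hS : IsNNSelection κ S) (t : T)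
    (q : (Fin n → Cov k × ℝ) × Cov k) : IsProbabilityMeasure (nnRule κ S t q) :=
  isProbabilityMeasure_weightedEmpirical (fun i => by split_ifs <;> positivity)
    (sum_nnWeight hκ (hS.2 _).1) _

lemma measurable_nnRule {k n κ : ℕ} {T : Type} [MeasurableSpace T]
    {S : T × (Fin n → Cov k) × Cov k → Finset (Fin n)} (hS : IsNNSelection κ S) :
    Measurable fun p : T × ((Fin n → Cov k × ℝ) × Cov k) => nnRule κ S p.1 p.2 := by
  refine measurable_weightedEmpirical (fun i => ?_) fun i => by fun_prop
  refine Measurable.ite ?_ measurable_const measurable_const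
  have hm : Measurable fun p : T × ((Fin n → Cov k × ℝ) × Cov k) =>
      (p.1, (fun j => (p.2.1 j).1), p.2.2) := by fun_prop
  exact hm (hS.1 i)

/-- The nearest neighbour method attains the rate `n ^ (-H / (2 * H + k))`. -/
lemma exists_maxRiskRand_nnRule_le {k : ℕ} (hk : 2 ≤ k) {H L M : ℝ} (hH : 0 < H) (hH1 : H ≤ 1)
    (hL : 0 < L) (hM : 0 < M) {A : ℝ} (hA : 0 ≤ A) :
    ∃ C : ℝ, ∀ n κ : ℕ, 1 ≤ n → 1 ≤ κ → (κ : ℝ) ≤ A * (n : ℝ) ^ (H / (H + (k : ℝ) / 2)) →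
      (n : ℝ) ^ (H / (H + (k : ℝ) / 2)) ≤ A * κ →
      ∀ (T : Type) [MeasurableSpace T] (ν : Measure T) [IsProbabilityMeasure ν]
      (S : T × (Fin n → Cov k) × Cov k → Finset (Fin n)), IsNNSelection κ S →
      maxRiskRand ν H L M (nnRule κ S) ≤ ENNReal.ofReal (C * (n : ℝ) ^ (-H / (2 * H + k))) := by
  refine ⟨√A * M + L * √k ^ H * 2 * (1 + 4 ^ k * A), fun n κ hn hκ hκ1 hκ2 T _ ν _ S hS =>
    iSup₂_le fun P hP => ?_⟩
  obtain ⟨r, hr0, hr1, -, hrH, hrn, hrk⟩ := rate_facts (k := k) hH hn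
  rw [hrk] at hκ1 hκ2
  rw [hrH]
  have hn0 : (0 : ℝ) < n := by exact_mod_cast hn
  have hκ0 : (0 : ℝ) < κ := by exact_mod_cast hκ
  -- Dyadic refinement stops at `2 ^ J ≤ 1 / r < 2 ^ (J + 1)`: there `κ / n * 2 ^ (J * k)` is still
  -- bounded, and the leading bias term is already of order `r ^ H`.
  obtain ⟨J, hJ1, hJ2⟩ := exists_nat_pow_near ((one_le_div hr0).2 hr1) (one_lt_two (α := ℝ))
  set s : ℝ := (2 : ℝ) ^ J with hs
  have hs0 : 0 < s := by positivity
  have hvar : √(1 / κ) ≤ √A * r ^ H := by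
    rw [← Real.sqrt_sq (by positivity : 0 ≤ r ^ H), ← Real.sqrt_mul hA]
    refine Real.sqrt_le_sqrt ?_
    rw [div_le_iff₀ hκ0]
    calc (1 : ℝ) = n * r ^ k * (r ^ H) ^ 2 := hrn.symm
      _ ≤ A * κ * (r ^ H) ^ 2 := by gcongr
      _ = _ := by ring
  have hsH : s ^ (-H) ≤ 2 * r ^ H := by
    have h1 : s⁻¹ ≤ 2 * r := by
      rw [pow_succ, div_lt_iff₀ hr0] at hJ2
      rw [inv_le_iff_one_le_mul₀ hs0]
      nlinarith
    rw [Real.rpow_neg hs0.le, ← Real.inv_rpow hs0.le]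
    calc s⁻¹ ^ H ≤ (2 * r) ^ H := by gcongr
      _ = 2 ^ H * r ^ H := Real.mul_rpow (by norm_num) hr0.le
      _ ≤ 2 * r ^ H := by
          gcongr
          simpa using Real.rpow_le_rpow_of_exponent_le (x := 2) (by norm_num) hH1
  have hcount : κ / (n + 1) * s ^ k ≤ A := by
    calc κ / (n + 1) * s ^ k ≤ A * (n * r ^ k) / n * (1 / r) ^ k := by
          gcongr
          linarith
      _ = A := by
          rw [one_div, inv_pow]
          field_simp
  have hconst : √(1 / κ) * M + L * √k ^ H * s ^ (-H) * (1 + 4 ^ k * (κ / (n + 1)) * s ^ k)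
      ≤ (√A * M + L * √k ^ H * 2 * (1 + 4 ^ k * A)) * r ^ H := by
    calc _ = √(1 / κ) * M + L * √k ^ H * s ^ (-H) * (1 + 4 ^ k * (κ / (n + 1) * s ^ k)) := by ring
      _ ≤ √A * r ^ H * M + L * √k ^ H * (2 * r ^ H) * (1 + 4 ^ k * A) := by gcongr
      _ = _ := by ring
  calc ∫⁻ t, risk P (nnRule κ S t) ∂ν
      ≤ ∫⁻ _t, ENNReal.ofReal ((√A * M + L * √k ^ H * 2 * (1 + 4 ^ k * A)) * r ^ H) ∂ν :=
        lintegral_mono fun t => (risk_nnRule_le hk hκ hH hH1 hL hM hS t J hP).trans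
          (ENNReal.ofReal_le_ofReal hconst)
    _ = _ := by rw [lintegral_const, measure_univ, mul_one]

lemma isBoxedKernel_uniform (k : ℕ) :
    IsBoxedKernel (Set.indicator {x : Cov k | ‖x‖ ≤ 1} fun _ => (1 : ℝ)) :=
  ⟨measurable_const.indicator (measurableSet_le measurable_norm measurable_const),
    1, 1, 1, 1, one_pos, le_rfl, one_pos, le_rfl, fun _ => ⟨le_rfl, le_rfl⟩⟩

end DistReg

theorem theorem2 (k : ℕ) (hk : 1 ≤ k) (H L M : ℝ) (hH : 0 < H) (hH1 : H ≤ 1)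
    (hL : 0 < L) (hM : 0 < M) :
    -- the minimax rate
    DistReg.SameRate (DistReg.minimaxRisk k H L M)
      (fun n => ENNReal.ofReal ((n : ℝ) ^ (-H / (2 * H + k)))) ∧
    -- the kernel method attains it
    (∀ K : DistReg.Cov k → ℝ, DistReg.IsBoxedKernel K →
      ∀ h : ℕ → ℝ, (∀ n, 0 < h n) →
        DistReg.SameRate (fun n => ENNReal.ofReal (h n))
          (fun n => ENNReal.ofReal ((n : ℝ) ^ (-1 / (2 * H + k)))) →
        DistReg.SameRate (fun n => DistReg.maxRisk H L M (DistReg.kernelRule n K (h n)))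
          (fun n => ENNReal.ofReal ((n : ℝ) ^ (-H / (2 * H + k))))) ∧
    -- the nearest neighbour method attains it in dimension at least two
    (2 ≤ k →
      ∀ (T : Type) [MeasurableSpace T] (ν : MeasureTheory.Measure T)
        [MeasureTheory.IsProbabilityMeasure ν] (κ : ℕ → ℕ)
        (S : ∀ n : ℕ, T × (Fin n → DistReg.Cov k) × DistReg.Cov k → Finset (Fin n)),
        (∀ n, 1 ≤ n → 1 ≤ κ n ∧ κ n ≤ n ∧ DistReg.IsNNSelection (κ n) (S n)) →
        DistReg.SameRate (fun n => (κ n : ENNReal))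
          (fun n => ENNReal.ofReal ((n : ℝ) ^ (H / (H + (k : ℝ) / 2)))) →
        DistReg.SameRate
          (fun n => DistReg.maxRiskRand ν H L M (DistReg.nnRule (κ n) (S n)))
          (fun n => ENNReal.ofReal ((n : ℝ) ^ (-H / (2 * H + k))))) := by
  obtain ⟨c, hc, hlow⟩ := DistReg.exists_rate_le_maxRisk k hH hH1 hL hM
  have hrate : ∀ n : ℕ, 0 ≤ (n : ℝ) ^ (-H / (2 * H + k)) := fun n => by positivity
  refine ⟨?_, fun K hK h hh hrh => ?_, fun hk2 T _ ν _ κ S hS hκ => ?_⟩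
  -- The minimax upper bound is witnessed by the uniform kernel with bandwidth exactly
  -- `n^(-1/(2H+k))`.
  · obtain ⟨C, hC⟩ := DistReg.exists_maxRisk_kernelRule_le k hH hL hM
      (DistReg.isBoxedKernel_uniform k) one_pos zero_le_one
    refine DistReg.sameRate_of_bounds (C := C) hc hrate ?_ ?_
    · filter_upwards [eventually_ge_atTop 1] with n hn
      exact le_iInf₂ fun G hG => hlow n hn G hG
    · filter_upwards [eventually_ge_atTop 1] with n hn
      have hK := DistReg.isBoxedKernel_uniform k
      exact (iInf₂_le _ (DistReg.isEstimator_kernelRule hn hK.1 hK.nonneg _)).trans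
        (hC n hn _ (one_mul _).le (one_mul _).ge)
  · obtain ⟨B, hB⟩ := hrh
    have hB1 : (0 : ℝ) < B + 1 := by positivity
    -- `B + 1` replaces `B` in the lower constant so that the reciprocal is positive without showing
    -- `B ≠ 0`.
    obtain ⟨C, hC⟩ := DistReg.exists_maxRisk_kernelRule_le k hH hL hM hK
      (a := 1 / (B + 1)) (A := B) (by positivity) B.coe_nonneg
    refine DistReg.sameRate_of_bounds (C := C) hc hrate ?_ ?_
    · filter_upwards [eventually_ge_atTop 1] with n hn
      exact hlow n hn _ (DistReg.isEstimator_kernelRule hn hK.1 hK.nonneg _)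
    · filter_upwards [eventually_ge_atTop 1, hB] with n hn hBn
      have h1 := DistReg.le_mul_of_ofReal_le (by positivity) hBn.1
      have h2 := DistReg.le_mul_of_ofReal_le (hh n).le hBn.2
      refine hC n hn _ ?_ h1
      rw [one_div_mul_eq_div, div_le_iff₀ hB1]
      nlinarith [hh n]
  -- Ties may be broken with auxiliary randomness, so the lower bound for randomised estimators is
  -- needed.
  · obtain ⟨c', hc', hlow'⟩ := DistReg.exists_rate_le_maxRiskRand k hH hH1 hL hM
    obtain ⟨B, hB⟩ := hκ
    obtain ⟨C, hC⟩ := DistReg.exists_maxRiskRand_nnRule_le hk2 hH hH1 hL hM (A := B) B.coe_nonneg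
    refine DistReg.sameRate_of_bounds (C := C) hc' hrate ?_ ?_
    · filter_upwards [eventually_ge_atTop 1] with n hn
      obtain ⟨h1, -, h3⟩ := hS n hn
      exact hlow' n hn T ν _ (DistReg.measurable_nnRule h3)
        (DistReg.isProbabilityMeasure_nnRule h1 h3)
    · filter_upwards [eventually_ge_atTop 1, hB] with n hn hBn
      obtain ⟨h1, -, h3⟩ := hS n hn
      rw [← ENNReal.ofReal_natCast] at hBn
      exact hC n (κ n) hn h1 (DistReg.le_mul_of_ofReal_le (by positivity) hBn.1)
        (DistReg.le_mul_of_ofReal_le (by positivity) hBn.2) T ν _ h3
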